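/- **Setting.** Let $f,h:[0,1]\to\mathbb R$ be twice continuously differentiable with $f(1)<0<f(0)$, $h(1)=0$, $h'(1)\neq 0$ and $h(x)>0$ for $x\in[0,1)$. For $\varepsilon>0$ let $x^\varepsilon=(x^\varepsilon_t)_{t\ge0}$ be the $[0,1]$-valued solution of $$\varepsilon\,\dot x^\varepsilon_t=\varepsilon f(x^\varepsilon_t)+x^\varepsilon_t\,h(x^\varepsilon_t),\qquad x^\varepsilon_0=0 .$$ Let $(\sigma^\varepsilon_n)_{n\ge1}$ be i.i.d. positive random variables with $\mathbb P(\sigma^\varepsilon_n>t)=\exp\big(-\varepsilon^{-1}\int_0^t h(x^\varepsilon_s)\,ds\big)$ for all $t>0$, and put $\tau^\varepsilon_0=0$, $\tau^\varepsilon_n=\sigma^\varepsilon_1+\dots+\sigma^\varepsilon_n$. The resetting process is $X^\varepsilon_t=x^\varepsilon_{t-\tau^\varepsilon_n}$ for $t\in[\tau^\varepsilon_n,\tau^\varepsilon_{n+1})$, $n\ge0$, and its pre-spikes are the points $(\tau^\varepsilon_i,z^\varepsilon_i)$, $i\ge1$, with $z_i^\varepsilon=X^\varepsilon_{\tau^\varepsilon_i-}$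 (the left limit). For $0\le s\le t$ and a Borel set $A\subset(0,1)$ let $N^\varepsilon_{(s,t]}(A)$ be the number of pre-spikes in $(s,t]\times A$. Fix $\beta\in(0,1/2)$ and let $e^\varepsilon_1=\inf\{t\ge0:\ X^\varepsilon_t>1-\varepsilon^\beta\}$; the event $\{e_1^\varepsilon\ge t\}$ means that there is no jump before time $t$. Finally let $\lambda_*$ be the measure on $[0,1]$ given by $\lambda_*(dx)=f(0)\,x^{-2}\,dx$. **Proposition.** Let $0<a\le b<1$ and $A=[a,b]$, so that $\lambda_*(A)=f(0)\,(a^{-1}-b^{-1})$. Let $n\ge0$ and $0=s_0<s_1<\dots<s_n<s_{n+1}=t$. Then $\mathbb P(e^\varepsilon_1\ge t)>0$ for all sufficiently small $\varepsilon>0$ and, conditionally on the event $\{e^\varepsilon_1\ge t\}$, the random vector $$\big(N^\varepsilon_{(s_i,s_{i+1}]}(A)\big)_{0\le i\le n}$$ converges in law, as $\varepsilon\to0$, to a vector $(\bar N_i)_{0\le i\le n}$ of independent random variables such that, for each $i$, $\bar N_i$ has the Poisson distribution with parameter $(s_{i+1}-s_i)\,\lambda_*(A)$. -/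

import Mathlib

open MeasureTheory ProbabilityTheory Filter Topology Set
open scoped ENNReal NNReal

/-- The standing assumptions on the drift `f` and on the resetting coefficient `h`. Both functions
are relevant on `[0, 1]` only. -/
structure ModelCoefficients (f h : ℝ → ℝ) : Prop where
  f_contDiff : ContDiffOn ℝ 2 f (Icc 0 1)
  h_contDiff : ContDiffOn ℝ 2 h (Icc 0 1)
  f_zero_pos : 0 < f 0
  f_one_neg : f 1 < 0
  h_one : h 1 = 0
  h_deriv_one : derivWithin h (Icc 0 1) 1 ≠ 0
  h_pos : ∀ y ∈ Ico (0 : ℝ) 1, 0 < h y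

/-- `x` is the trajectory, with values in `[0, 1]` and started from `0`, of the differential equation
`ε ẋ = ε f(x) + x h(x)` on `[0, ∞)`. -/
structure IsDeterministicFlow (f h : ℝ → ℝ) (ε : ℝ) (x : ℝ → ℝ) : Prop where
  initial : x 0 = 0
  mem_Icc : ∀ t, 0 ≤ t → x t ∈ Icc (0 : ℝ) 1
  ode : ∀ t, 0 ≤ t →
    HasDerivWithinAt x (ε⁻¹ * (ε * f (x t) + x t * h (x t))) (Ici 0) t

/-- `σ 0, σ 1, …` (they are `σ₁, σ₂, …` on paper) are i.i.d. positive random variables with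
`P(σₙ > t) = exp (-ε⁻¹ ∫₀ᵗ h(x_s) ds)` for every `t > 0`, where `x` is the deterministic flow. -/
structure IsInterarrivalSequence {Ω : Type*} [MeasurableSpace Ω] (P : Measure Ω)
    (h : ℝ → ℝ) (ε : ℝ) (x : ℝ → ℝ) (σ : ℕ → Ω → ℝ) : Prop where
  measurable : ∀ n, Measurable (σ n)
  pos : ∀ n ω, 0 < σ n ω
  indep : iIndepFun σ P
  tail : ∀ n t, 0 < t →
    P {ω | t < σ n ω} = ENNReal.ofReal (Real.exp (-(ε⁻¹ * ∫ s in (0 : ℝ)..t, h (x s))))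

/-- The pre-spike times `τ₀ = 0`, `τₙ = σ₁ + … + σₙ`, for one realisation of the sequence `σ`. -/
def preSpikeTime (σ : ℕ → ℝ) (n : ℕ) : ℝ := ∑ i ∈ Finset.range n, σ i

open Classical in
/-- One trajectory of the resetting dynamics: it is `x (t - τₙ)` for `t ∈ [τₙ, τₙ₊₁)`, i.e. the
flow is restarted from `0` at each pre-spike time. (For positive `σ` at most one term of the series
is nonzero. The value is `0` at times in no interval `[τₙ, τₙ₊₁)`: negative times, and times after
an explosion, which has probability `0`.) -/
noncomputable def resetProcess (x : ℝ → ℝ) (σ : ℕ → ℝ) (t : ℝ) : ℝ :=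
  ∑' n : ℕ, if t ∈ Ico (preSpikeTime σ n) (preSpikeTime σ (n + 1))
    then x (t - preSpikeTime σ n) else 0

/-- The pre-spikes: the points `(τᵢ, X_{τᵢ-})`, `i ≥ 1`. -/
noncomputable def preSpikes (x : ℝ → ℝ) (σ : ℕ → ℝ) : Set (ℝ × ℝ) :=
  {p | ∃ i : ℕ, 1 ≤ i ∧
    p = (preSpikeTime σ i, Function.leftLim (resetProcess x σ) (preSpikeTime σ i))}

/-- The number `N_{(s, t]}(A)` of pre-spikes in `(s, t] × A`. (The set is finite almost surely.) -/
noncomputable def preSpikeCount (x : ℝ → ℝ) (σ : ℕ → ℝ) (s t : ℝ) (A : Set ℝ) : ℕ :=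
  (preSpikes x σ ∩ Ioc s t ×ˢ A).ncard

/-- The time `e₁ = inf {t ≥ 0 ; X_t > y}` in `[0, ∞]` (it is `∞` if the set is empty), to be used
with the level `y = 1 - ε ^ β`. -/
noncomputable def firstJumpTime (y : ℝ) (x : ℝ → ℝ) (σ : ℕ → ℝ) : EReal :=
  ⨅ t ∈ {t : ℝ | 0 ≤ t ∧ y < resetProcess x σ t}, (t : EReal)

/-- The no-jump event `{e₁ ≥ t}`. -/
def noJumpEvent {Ω : Type*} (ε β : ℝ) (x : ℝ → ℝ) (σ : ℕ → Ω → ℝ) (t : ℝ) : Set Ω :=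
  {ω | (t : EReal) ≤ firstJumpTime (1 - ε ^ β) x (fun n => σ n ω)}

/-- The random vector `(N_{(sᵢ, sᵢ₊₁]}(A))` for `i = 0, …, n`. -/
noncomputable def countVector {Ω : Type*} (x : ℝ → ℝ) (σ : ℕ → Ω → ℝ) {n : ℕ}
    (s : Fin (n + 2) → ℝ) (A : Set ℝ) (ω : Ω) (i : Fin (n + 1)) : ℕ :=
  preSpikeCount x (fun m => σ m ω) (s i.castSucc) (s i.succ) A

/-- The law of the random variable `N` under the conditional probability `P( · | B)`. -/
noncomputable def conditionalLaw {Ω E : Type*} [MeasurableSpace Ω] [MeasurableSpace E]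
    (P : Measure Ω) (B : Set Ω) (N : Ω → E) : FiniteMeasure E :=
  ⟨(ProbabilityTheory.cond P B).map N, inferInstance⟩

/-- The intensity measure `λ_*(dx) = f(0) x⁻² dx` on `[0, 1]`. -/
noncomputable def spikeIntensity (f : ℝ → ℝ) : Measure ℝ :=
  (volume.restrict (Icc 0 1)).withDensity fun y => ENNReal.ofReal (f 0 / y ^ 2)

/-- The law of a vector of independent Poisson variables with parameters `r i`. -/
noncomputable def independentPoissonLaw {ι : Type*} [Fintype ι] (r : ι → ℝ≥0) :
    FiniteMeasure (ι → ℕ) :=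
  ⟨Measure.pi fun i => poissonMeasure (r i), inferInstance⟩

/-! ### Pathwise description of spikes and jumps by interarrival times -/

section Paths

/-! Write `R = h 0 / ε`, and let `T`, `α`, `β` be the times at which the flow reaches `1 - ε ^ β`,
`a` and `b` (from here on `β` is mostly this last time, not the exponent). The flow is restarted
afresh in each cycle, so a pre-spike has height in `[a, b]` exactly when the interarrival time lies
in `[α, β]`, and a jump needs an interarrival time larger than `T`. The problem thus concerns rare
values in an i.i.d. row.

The rates come from a near-conservation law. With `c = f 0 / h 0`, the logarithmic derivative of `x
+ ε c` differs from `ε⁻¹ h(x)` by a bounded amount (`abs_log_sub_cumulativeHazard_le`). Over the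
vanishing time needed to reach level `y`, the survival probability is therefore equivalent to `ε c /
y`, and `R` times it tends to `f 0 / y`. A similar estimate shows that the interarrival time
truncated at `T` has mean equivalent to `1 / R`.

It remains to replace random index ranges by deterministic ones. By Chebyshev, the truncated
pre-spike times cross a fixed time `s` at an index close to `s R`. A window of `2 η R` indices
around it contains an interarrival time at least `α` only with probability of order `η`. Off a
negligible event (`tendsto_measureReal_not_isLocalized`), the counts are thus those over the index
blocks delimited by `⌊s_i R⌋`, and absence of a jump means that no interarrival time in these blocks
exceeds `T`. Blocks are independent, so the joint probability is a product of binomial-type terms.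
It converges to Poisson weights times the limiting no-jump probability, which the conditioning
divides out (`tendsto_conditionalLaw_renewalRow`). -/

theorem preSpikeTime_succ (σ : ℕ → ℝ) (n : ℕ) :
    preSpikeTime σ (n + 1) = preSpikeTime σ n + σ n :=
  Finset.sum_range_succ _ _

theorem preSpikeTime_strictMono {σ : ℕ → ℝ} (hσ : ∀ n, 0 < σ n) :
    StrictMono (preSpikeTime σ) :=
  strictMono_nat_of_lt_succ fun n => by
    rw [preSpikeTime_succ]; linarith [hσ n]

theorem preSpikeTime_le_preSpikeTime {σ σ' : ℕ → ℝ} (h : ∀ n, σ n ≤ σ' n) (n : ℕ) :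
    preSpikeTime σ n ≤ preSpikeTime σ' n :=
  Finset.sum_le_sum fun i _ => h i

theorem preSpikeTime_congr {σ σ' : ℕ → ℝ} {n : ℕ} (h : ∀ i < n, σ i = σ' i) :
    preSpikeTime σ n = preSpikeTime σ' n :=
  Finset.sum_congr rfl fun i hi => h i (Finset.mem_range.1 hi)

theorem resetProcess_eq (x : ℝ → ℝ) {σ : ℕ → ℝ} (hσ : ∀ n, 0 < σ n) {n : ℕ} {t : ℝ}
    (ht : t ∈ Ico (preSpikeTime σ n) (preSpikeTime σ (n + 1))) :
    resetProcess x σ t = x (t - preSpikeTime σ n) := by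
  have hmono := (preSpikeTime_strictMono hσ).monotone
  unfold resetProcess
  rw [tsum_eq_single n, if_pos ht]
  intro m hm
  refine if_neg fun hm' => ?_
  rcases lt_or_gt_of_ne hm with h | h
  · exact absurd (hm'.2.trans_le (hmono h)) (not_lt.2 ht.1)
  · exact absurd (ht.2.trans_le (hmono h)) (not_lt.2 hm'.1)

theorem resetProcess_eq_zero (x : ℝ → ℝ) {σ : ℕ → ℝ} {t : ℝ}
    (ht : ∀ n, t ∉ Ico (preSpikeTime σ n) (preSpikeTime σ (n + 1))) :
    resetProcess x σ t = 0 := by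
  unfold resetProcess
  simp [ht]

theorem leftLim_resetProcess {x : ℝ → ℝ} (hx : ∀ s, 0 < s → ContinuousAt x s) {σ : ℕ → ℝ}
    (hσ : ∀ n, 0 < σ n) (n : ℕ) :
    Function.leftLim (resetProcess x σ) (preSpikeTime σ (n + 1)) = x (σ n) := by
  apply leftLim_eq_of_tendsto
  have h1 : Tendsto (fun t => x (t - preSpikeTime σ n)) (𝓝[<] (preSpikeTime σ (n + 1)))
      (𝓝 (x (σ n))) := by
    refine Tendsto.mono_left ?_ nhdsWithin_le_nhds
    have h2 : Tendsto (fun t => t - preSpikeTime σ n) (𝓝 (preSpikeTime σ (n + 1))) (𝓝 (σ n)) := by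
      have : Continuous fun t : ℝ => t - preSpikeTime σ n := by fun_prop
      simpa [preSpikeTime_succ] using this.tendsto (preSpikeTime σ (n + 1))
    exact (hx _ (hσ n)).tendsto.comp h2
  refine h1.congr' ?_
  have hlt : preSpikeTime σ n < preSpikeTime σ (n + 1) := preSpikeTime_strictMono hσ n.lt_succ_self
  filter_upwards [Ioo_mem_nhdsLT hlt] with t ht
  exact (resetProcess_eq x hσ ⟨ht.1.le, ht.2⟩).symm

/-- The trajectory `x` is below the level `y` before time `T` and above it after. -/
structure IsCrossingTime (x : ℝ → ℝ) (y T : ℝ) : Prop where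
  pos : 0 < T
  lt_iff : ∀ s, 0 ≤ s → (y < x s ↔ T < s)
  le_iff : ∀ s, 0 ≤ s → (y ≤ x s ↔ T ≤ s)

/-- The left limit at the end of cycle `j` is `x (σ j)`, and the crossing times turn bounds on this
height into bounds on `σ j`. Pre-spike times are strictly increasing, so counting points is counting
indices; index `j` stands for pre-spike `j + 1`. -/
theorem preSpikeCount_eq {x : ℝ → ℝ} (hx : ∀ s, 0 < s → ContinuousAt x s) {σ : ℕ → ℝ}
    (hσ : ∀ n, 0 < σ n) {a b α β : ℝ} (hα : IsCrossingTime x a α) (hβ : IsCrossingTime x b β)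
    (s t : ℝ) :
    preSpikeCount x σ s t (Icc a b) =
      {j : ℕ | preSpikeTime σ (j + 1) ∈ Ioc s t ∧ σ j ∈ Icc α β}.ncard := by
  have hinj : Function.Injective fun j : ℕ => (preSpikeTime σ (j + 1), x (σ j)) := by
    intro i j hij
    have := (preSpikeTime_strictMono hσ).injective (congrArg Prod.fst hij)
    omega
  rw [← Set.ncard_image_of_injective _ hinj]
  unfold preSpikeCount
  have hb (j : ℕ) : x (σ j) ≤ b ↔ σ j ≤ β := by
    rw [← not_lt, hβ.lt_iff _ (hσ j).le, not_lt]
  congr 1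
  ext p
  simp only [preSpikes, mem_inter_iff, mem_ofPred_eq, mem_prod, mem_image]
  constructor
  · rintro ⟨⟨i, hi, rfl⟩, h1, h2⟩
    obtain ⟨j, rfl⟩ : ∃ j, i = j + 1 := ⟨i - 1, by omega⟩
    rw [leftLim_resetProcess hx hσ] at h2 ⊢
    exact ⟨j, ⟨h1, (hα.le_iff _ (hσ j).le).1 h2.1, (hb j).1 h2.2⟩, rfl⟩
  · rintro ⟨j, ⟨h1, h2⟩, rfl⟩
    refine ⟨⟨j + 1, by omega, ?_⟩, h1, (hα.le_iff _ (hσ j).le).2 h2.1, (hb j).2 h2.2⟩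
    rw [leftLim_resetProcess hx hσ]

/-- Within cycle `n` the process is above `y` exactly when the age of the cycle exceeds `T`, which
happens only if `T < σ n`, and then from time `τₙ + T` on. -/
theorem le_firstJumpTime_iff {x : ℝ → ℝ} {σ : ℕ → ℝ} (hσ : ∀ n, 0 < σ n) {y T : ℝ} (hy : 0 ≤ y)
    (hT : IsCrossingTime x y T) (t : ℝ) :
    (t : EReal) ≤ firstJumpTime y x σ ↔ ∀ n, T < σ n → t ≤ preSpikeTime σ n + T := by
  unfold firstJumpTime
  simp only [le_iInf_iff, EReal.coe_le_coe_iff, mem_ofPred_eq]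
  have hτ0 (n : ℕ) : 0 ≤ preSpikeTime σ n := Finset.sum_nonneg fun i _ => (hσ i).le
  constructor
  · intro h n hn
    refine le_of_forall_gt_imp_ge_of_dense fun s hs => ?_
    rcases lt_or_ge s (preSpikeTime σ (n + 1)) with hs' | hs'
    · refine h s ⟨by linarith [hτ0 n, hT.pos], ?_⟩
      rw [resetProcess_eq x hσ ⟨by linarith [hT.pos], hs'⟩, hT.lt_iff _ (by linarith [hT.pos])]
      linarith
    · rw [preSpikeTime_succ] at hs'
      -- If `s` is past the end of the cycle, the midpoint of the part of the cycle spent above `y`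
      -- serves as the witness.
      refine (h (preSpikeTime σ n + (T + σ n) / 2) ⟨by linarith [hτ0 n, hT.pos], ?_⟩).trans
        (by linarith)
      rw [resetProcess_eq x hσ (n := n) ⟨by linarith [hT.pos, hσ n], by
        rw [preSpikeTime_succ]; linarith⟩, hT.lt_iff _ (by linarith [hT.pos])]
      linarith
  · rintro h s ⟨hs0, hs⟩
    by_cases hex : ∃ n, s ∈ Ico (preSpikeTime σ n) (preSpikeTime σ (n + 1))
    · obtain ⟨n, hn⟩ := hex
      rw [resetProcess_eq x hσ hn, hT.lt_iff _ (by linarith [hn.1])] at hs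
      have := hn.2
      rw [preSpikeTime_succ] at this
      linarith [h n (by linarith)]
    -- Outside all cycles the process has the default value `0`, which cannot exceed a level `y ≥
    -- 0`.
    · rw [resetProcess_eq_zero x (not_exists.1 hex)] at hs
      linarith

end Paths

/-! ### Replacing random index ranges by deterministic ones -/

section Localization

variable {σ : ℕ → ℝ} {T : ℝ}

theorem preSpikeTime_truncated_le (σ : ℕ → ℝ) (T : ℝ) (n : ℕ) :
    preSpikeTime (fun j => min (σ j) T) n ≤ preSpikeTime σ n :=
  preSpikeTime_le_preSpikeTime (fun _ => min_le_left _ _) n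

theorem preSpikeTime_truncated_eq {n : ℕ} (h : ∀ i < n, σ i ≤ T) :
    preSpikeTime (fun j => min (σ j) T) n = preSpikeTime σ n :=
  preSpikeTime_congr fun i hi => min_eq_left (h i hi)

/-- Between the indices `lo` and `hi` the truncated pre-spike times cross `s`, and none of the
interarrival times with these indices is larger than `α`. -/
structure IsLocalized (σ : ℕ → ℝ) (T α s : ℝ) (lo m hi : ℕ) : Prop where
  lo_le : lo ≤ m
  le_hi : m ≤ hi
  lt : preSpikeTime (fun j => min (σ j) T) lo < s
  gt : s < preSpikeTime (fun j => min (σ j) T) hi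
  small : ∀ j, lo ≤ j → j < hi → σ j < α

variable {α s : ℝ} {lo m hi : ℕ}

/-- The first `j < m` with `σ j > T` would have to be below `lo`. Until then truncation changes
nothing, so its level crossing occurs at the truncated time `j + 1`, hence before `s`. Conversely, a
long interarrival time of index at least `m` has index at least `hi`, and its crossing comes after
`s`. -/
theorem IsLocalized.noJump_iff (h : IsLocalized σ T α s lo m hi) (hσ : ∀ n, 0 < σ n) (hT : 0 < T)
    (hα : α ≤ T) :
    (∀ n, T < σ n → s ≤ preSpikeTime σ n + T) ↔ ∀ j < m, σ j ≤ T := by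
  have hmono : Monotone (preSpikeTime fun j => min (σ j) T) :=
    (preSpikeTime_strictMono fun j => lt_min (hσ j) hT).monotone
  constructor
  · intro hB j
    induction j using Nat.strong_induction_on with
    | _ j ih =>
      intro hj
      by_contra! hlt
      have hlo : j < lo := by
        by_contra! hlo
        linarith [h.small j hlo (hj.trans_le h.le_hi)]
      have h1 := hB j hlt
      rw [← preSpikeTime_truncated_eq (T := T) fun i hi => ih i hi (hi.trans hj)] at h1
      have h2 := preSpikeTime_succ (fun j => min (σ j) T) j
      rw [min_eq_right hlt.le] at h2
      linarith [hmono hlo, h.lt]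
  · intro hB n hn
    have hm : m ≤ n := by
      by_contra! hlt
      linarith [hB n hlt]
    have hhi : hi ≤ n := by
      by_contra! hlt
      linarith [h.small n (h.lo_le.trans hm) hlt]
    have h2 := preSpikeTime_succ (fun j => min (σ j) T) n
    rw [min_eq_right hn.le] at h2
    linarith [hmono (hhi.trans n.le_succ), h.gt, preSpikeTime_truncated_le σ T n]

/-- An index with `σ j ≥ α` avoids the window between `lo` and `hi`. Below `lo` the true and
truncated times agree and are less than `s`; from `hi` on the truncated time, a lower bound for the
true one, exceeds `s`. -/
theorem IsLocalized.preSpikeTime_le_iff (h : IsLocalized σ T α s lo m hi) (hσ : ∀ n, 0 < σ n)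
    (hT : 0 < T) (hm : ∀ j < m, σ j ≤ T) {j : ℕ} (hj : α ≤ σ j) :
    preSpikeTime σ (j + 1) ≤ s ↔ j < m := by
  have hmono : Monotone (preSpikeTime fun j => min (σ j) T) :=
    (preSpikeTime_strictMono fun j => lt_min (hσ j) hT).monotone
  constructor
  · intro hle
    by_contra! hmj
    have hhi : hi ≤ j := by
      by_contra! hlt
      linarith [h.small j (h.lo_le.trans hmj) hlt]
    linarith [hmono (hhi.trans j.le_succ), h.gt, preSpikeTime_truncated_le σ T (j + 1)]
  · intro hjm
    have hlo : j < lo := by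
      by_contra! hlo
      linarith [h.small j hlo (hjm.trans_le h.le_hi)]
    rw [← preSpikeTime_truncated_eq (T := T) fun i hi => hm i (by omega)]
    linarith [hmono (Nat.succ_le_of_lt hlo), h.lt]

theorem ncard_preSpikes_eq_card {n : ℕ} {s : Fin (n + 2) → ℝ} {m : Fin (n + 2) → ℕ} {α β : ℝ}
    (hσ : ∀ n, 0 < σ n) (hs0 : s 0 = 0) (hm0 : m 0 = 0) (hT : 0 < T)
    (hloc : ∀ i : Fin (n + 1), ∃ lo hi, IsLocalized σ T α (s i.succ) lo (m i.succ) hi)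
    (hm : ∀ i, ∀ j < m i, σ j ≤ T) (i : Fin (n + 1)) :
    {j : ℕ | preSpikeTime σ (j + 1) ∈ Ioc (s i.castSucc) (s i.succ) ∧ σ j ∈ Icc α β}.ncard =
      ((Finset.Ico (m i.castSucc) (m i.succ)).filter fun j => σ j ∈ Icc α β).card := by
  have key (k : Fin (n + 2)) (j : ℕ) (hj : α ≤ σ j) : preSpikeTime σ (j + 1) ≤ s k ↔ j < m k := by
    refine Fin.cases ?_ (fun k => ?_) k
    -- At the initial endpoint both sides are false, since pre-spike `j + 1` occurs after time `0`.
    · have : 0 < preSpikeTime σ (j + 1) :=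
        (Finset.sum_pos (fun i _ => hσ i) ⟨0, by simp⟩)
      simp [hs0, hm0, this]
    · obtain ⟨lo, hi, hl⟩ := hloc k
      exact hl.preSpikeTime_le_iff hσ hT (hm _) hj
  rw [← Set.ncard_coe_finset]
  congr 1
  ext j
  simp only [mem_ofPred_eq, Finset.coe_filter, Finset.mem_Ico, mem_Ioc]
  constructor
  · rintro ⟨⟨h1, h2⟩, h3⟩
    exact ⟨⟨not_lt.1 fun h => absurd ((key _ j h3.1).2 h) (not_le.2 h1), (key _ j h3.1).1 h2⟩, h3⟩
  · rintro ⟨⟨h1, h2⟩, h3⟩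
    exact ⟨⟨not_le.1 fun h => absurd ((key _ j h3.1).1 h) (not_lt.2 h1), (key _ j h3.1).2 h2⟩, h3⟩

end Localization

/-! ### Measurability of the counts -/

section Measurability

variable {Ω : Type*} [MeasurableSpace Ω]

theorem measurable_ncard_of_forall {p : ℕ → Ω → Prop} (hp : ∀ j, MeasurableSet {ω | p j ω}) :
    Measurable fun ω => {j : ℕ | p j ω}.ncard := by
  classical
  -- The count is a sum of indicators. For infinitely many indices, `toReal` of `∞` and `ncard` both
  -- give `0`, so the identity needs no finiteness assumption.
  have h : (fun ω => {j : ℕ | p j ω}.ncard) =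
      fun ω => ⌊(∑' j : ℕ, {ω | p j ω}.indicator (1 : Ω → ℝ≥0∞) ω).toReal⌋₊ := by
    funext ω
    have h1 : ∑' j : ℕ, {ω | p j ω}.indicator (1 : Ω → ℝ≥0∞) ω = {j : ℕ | p j ω}.encard := by
      rw [← ENNReal.tsum_set_one, tsum_subtype {j : ℕ | p j ω} fun _ => (1 : ℝ≥0∞)]
      rfl
    rw [h1]
    by_cases hfin : {j : ℕ | p j ω}.Finite
    · rw [hfin.encard_eq_coe_toFinset_card, Set.ncard_eq_toFinset_card _ hfin]
      simp
    · rw [Set.Infinite.encard_eq hfin, Set.Infinite.ncard hfin]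
      simp
  rw [h]
  exact Nat.measurable_floor.comp (Measurable.tsum fun j =>
    measurable_one.indicator (hp j)).ennreal_toReal

theorem measurable_preSpikeTime {σ : ℕ → Ω → ℝ} (hσ : ∀ n, Measurable (σ n)) (n : ℕ) :
    Measurable fun ω => preSpikeTime (fun j => σ j ω) n :=
  Finset.measurable_fun_sum _ fun i _ => hσ i

end Measurability

/-! ### Independent counts over disjoint blocks of indices -/

section Blocks

variable {Ω : Type*} [MeasurableSpace Ω] {P : Measure Ω} {σ : ℕ → Ω → ℝ}
  {κ : Type*} [Fintype κ] {I : κ → Finset ℕ}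

theorem ProbabilityTheory.iIndepFun.measureReal_forall_blocks [IsProbabilityMeasure P]
    (hσ : iIndepFun σ P) (hI : Pairwise fun i j => Disjoint (I i) (I j)) {W : κ → ℕ → Set ℝ}
    (hW : ∀ i j, MeasurableSet (W i j)) :
    P.real {ω | ∀ i, ∀ j ∈ I i, σ j ω ∈ W i j} = ∏ i, ∏ j ∈ I i, P.real {ω | σ j ω ∈ W i j} := by
  classical
  have h := hσ.meas_biInter (S := Finset.univ.biUnion I)
    (s := fun j => σ j ⁻¹' ⋂ i, ⋂ (_ : j ∈ I i), W i j) fun j _ =>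
      ⟨_, MeasurableSet.iInter fun i => MeasurableSet.iInter fun _ => hW i j, rfl⟩
  have h1 : {ω | ∀ i, ∀ j ∈ I i, σ j ω ∈ W i j} =
      ⋂ j ∈ Finset.univ.biUnion I, σ j ⁻¹' ⋂ i, ⋂ (_ : j ∈ I i), W i j := by
    ext ω
    simp only [mem_ofPred_eq, Finset.mem_biUnion, Finset.mem_univ, true_and, mem_iInter,
      mem_preimage]
    exact ⟨fun h j _ i hj => h i j hj, fun h i j hj => h j ⟨i, hj⟩ i hj⟩
  rw [h1, measureReal_def, h, ENNReal.toReal_prod, Finset.prod_biUnion fun i _ j _ hij => hI hij]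
  refine Finset.prod_congr rfl fun i _ => Finset.prod_congr rfl fun j hj => ?_
  rw [measureReal_def]
  congr 2
  ext ω
  simp only [mem_preimage, mem_iInter, mem_ofPred_eq]
  refine ⟨fun h => h i hj, fun h i' hj' => ?_⟩
  obtain rfl : i = i' := by
    by_contra hne
    exact Finset.disjoint_left.1 (hI hne) hj hj'
  exact h

/-- Decompose according to which indices of each block fall in `U`. Disjointness of `U` and `V`
makes these events disjoint, and by independence each has the same product probability. -/
theorem ProbabilityTheory.iIndepFun.measureReal_block_counts [IsProbabilityMeasure P]
    (hσ : iIndepFun σ P) (hm : ∀ j, Measurable (σ j))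
    (hI : Pairwise fun i j => Disjoint (I i) (I j)) {U V : Set ℝ}
    [DecidablePred (· ∈ U)] (hU : MeasurableSet U) (hV : MeasurableSet V) (hUV : Disjoint U V)
    {q w : ℝ} (hq : ∀ j, P.real {ω | σ j ω ∈ U} = q) (hw : ∀ j, P.real {ω | σ j ω ∈ V} = w)
    (k : κ → ℕ) :
    P.real {ω | ∀ i, (∀ j ∈ I i, σ j ω ∈ U ∪ V) ∧ ((I i).filter fun j => σ j ω ∈ U).card = k i} =
      ∏ i, ((I i).card.choose (k i) * q ^ k i * w ^ ((I i).card - k i)) := by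
  classical
  let E : (κ → Finset ℕ) → Set Ω := fun S =>
    {ω | ∀ i, ∀ j ∈ I i, σ j ω ∈ if j ∈ S i then U else V}
  let F : Finset (κ → Finset ℕ) := Fintype.piFinset fun i => (I i).powersetCard (k i)
  have hF {S} : S ∈ F ↔ ∀ i, S i ⊆ I i ∧ (S i).card = k i := by
    simp [F, Fintype.mem_piFinset, Finset.mem_powersetCard]
  have hEeq : {ω | ∀ i, (∀ j ∈ I i, σ j ω ∈ U ∪ V) ∧
      ((I i).filter fun j => σ j ω ∈ U).card = k i} = ⋃ S ∈ F, E S := by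
    ext ω
    simp only [mem_ofPred_eq, mem_iUnion, exists_prop, E]
    constructor
    · intro h
      refine ⟨fun i => (I i).filter fun j => σ j ω ∈ U,
        hF.2 fun i => ⟨Finset.filter_subset _ _, (h i).2⟩, fun i j hj => ?_⟩
      by_cases hjU : σ j ω ∈ U
      · rw [if_pos (Finset.mem_filter.2 ⟨hj, hjU⟩)]
        exact hjU
      · rw [if_neg fun h' : j ∈ (I i).filter fun j => σ j ω ∈ U => hjU (Finset.mem_filter.1 h').2]
        exact ((h i).1 j hj).resolve_left hjU
    · rintro ⟨S, hS, h⟩ i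
      have hSi := hF.1 hS i
      refine ⟨fun j hj => ?_, ?_⟩
      · have := h i j hj
        split_ifs at this
        exacts [Or.inl this, Or.inr this]
      · rw [← hSi.2]
        congr 1
        ext j
        rw [Finset.mem_filter]
        constructor
        · rintro ⟨hj, hjU⟩
          by_contra hjS
          have := h i j hj
          rw [if_neg hjS] at this
          exact Set.disjoint_left.1 hUV hjU this
        · intro hjS
          have := h i j (hSi.1 hjS)
          rw [if_pos hjS] at this
          exact ⟨hSi.1 hjS, this⟩
  have hWm (S : κ → Finset ℕ) (i : κ) (j : ℕ) : MeasurableSet (if j ∈ S i then U else V) := by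
    split_ifs <;> assumption
  have hEm (S) : MeasurableSet (E S) := by
    have : E S = ⋂ i, ⋂ j ∈ I i, σ j ⁻¹' (if j ∈ S i then U else V) := by
      ext ω; simp only [E, mem_ofPred_eq, mem_iInter, mem_preimage]
    rw [this]
    exact MeasurableSet.iInter fun i => Finset.measurableSet_biInter _ fun j _ =>
      hm j (hWm S i j)
  have hdisj : PairwiseDisjoint (F : Set (κ → Finset ℕ)) E := by
    have key : ∀ S ∈ F, ∀ S' ∈ F, ∀ ω ∈ E S, ω ∈ E S' → ∀ i, S i ⊆ S' i := by
      intro S hS S' hS' ω h h' i j hj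
      by_contra hj'
      have hjI := (hF.1 hS i).1 hj
      have h1 := h i j hjI
      have h2 := h' i j hjI
      rw [if_pos hj] at h1
      rw [if_neg hj'] at h2
      exact Set.disjoint_left.1 hUV h1 h2
    intro S hS S' hS' hne
    refine Set.disjoint_left.2 fun ω h h' => hne (funext fun i => ?_)
    exact (key S hS S' hS' ω h h' i).antisymm (key S' hS' S hS ω h' h i)
  rw [hEeq, measureReal_biUnion_finset hdisj fun S _ => hEm S]
  have hterm : ∀ S ∈ F, P.real (E S) = ∏ i, (q ^ k i * w ^ ((I i).card - k i)) := by
    intro S hS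
    rw [hσ.measureReal_forall_blocks hI (hWm S)]
    refine Finset.prod_congr rfl fun i _ => ?_
    have hSi := hF.1 hS i
    have h1 : ∀ j ∈ I i, P.real {ω | σ j ω ∈ if j ∈ S i then U else V} =
        if j ∈ S i then q else w := by
      intro j _
      split_ifs
      exacts [hq j, hw j]
    rw [Finset.prod_congr rfl h1, Finset.prod_ite, Finset.prod_const, Finset.prod_const]
    have h2 : (I i).filter (· ∈ S i) = S i := by
      ext j
      simpa using fun h => hSi.1 h
    have h3 : (I i).filter (· ∉ S i) = I i \ S i := by
      ext j; simp
    rw [h2, h3, Finset.card_sdiff_of_subset hSi.1, hSi.2]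
  rw [Finset.sum_congr rfl hterm, Finset.sum_const, Fintype.card_piFinset]
  simp only [Finset.card_powersetCard, nsmul_eq_mul, Nat.cast_prod, ← Finset.prod_mul_distrib,
    mul_assoc]

end Blocks

/-! ### Poisson limits of binomial terms -/

section Limits

variable {ι : Type*} {l : Filter ι}

theorem tendsto_one_sub_pow_exp_neg {N : ι → ℕ} {v : ι → ℝ} {θ : ℝ}
    (hN : Tendsto (fun i => N i * v i) l (𝓝 θ)) (hv : Tendsto v l (𝓝 0)) :
    Tendsto (fun i => (1 - v i) ^ N i) l (𝓝 (Real.exp (-θ))) := by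
  have hpos : ∀ᶠ i in l, 0 < 1 - v i := by
    filter_upwards [hv.eventually_lt_const one_pos] with i hi
    linarith
  -- Squeeze `log (1 - v)` between `-v / (1 - v)` and `-v`.
  have hlog : Tendsto (fun i => N i * Real.log (1 - v i)) l (𝓝 (-θ)) := by
    have h1 : Tendsto (fun i => -(N i * v i) / (1 - v i)) l (𝓝 (-θ)) := by
      have := hN.neg.div (tendsto_const_nhds.sub hv) (by norm_num : (1 : ℝ) - 0 ≠ 0)
      rw [sub_zero, div_one] at this
      exact this
    refine tendsto_of_tendsto_of_tendsto_of_le_of_le' h1 hN.neg ?_ ?_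
    · filter_upwards [hpos] with i hi
      have h2 := Real.one_sub_inv_le_log_of_pos hi
      have h3 : -(N i * v i) / (1 - v i) = N i * (1 - (1 - v i)⁻¹) := by
        field_simp; ring
      rw [h3]
      gcongr
    · filter_upwards [hpos] with i hi
      have h2 := Real.log_le_sub_one_of_pos hi
      have h3 : -(N i * v i) = N i * (1 - v i - 1) := by ring
      rw [h3]
      gcongr
  refine ((Real.continuous_exp.tendsto _).comp hlog).congr' ?_
  filter_upwards [hpos] with i hi
  simp [← Real.rpow_natCast, Real.rpow_def_of_pos hi, mul_comm]

theorem tendsto_choose_mul_pow_mul_pow {m : ι → ℕ} {q v : ι → ℝ} {lam θ : ℝ} (k : ℕ)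
    (hm : Tendsto m l atTop) (hq : Tendsto (fun i => m i * q i) l (𝓝 lam))
    (hmv : Tendsto (fun i => m i * v i) l (𝓝 θ)) (hv : Tendsto v l (𝓝 0)) :
    Tendsto (fun i => (m i).choose k * q i ^ k * (1 - v i) ^ (m i - k)) l
      (𝓝 (lam ^ k / k.factorial * Real.exp (-θ))) := by
  refine Tendsto.mul ?_ (tendsto_one_sub_pow_exp_neg ?_ hv)
  · have h1 := ((isEquivalent_choose k).comp_tendsto hm).mul
      (Asymptotics.IsEquivalent.refl (u := fun i => q i ^ k))
    have h2 : Tendsto (fun i => (m i * q i) ^ k / (k.factorial : ℝ)) l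
        (𝓝 (lam ^ k / k.factorial)) := (hq.pow k).div_const _
    refine h1.symm.tendsto_nhds (h2.congr fun i => ?_)
    simp only [Pi.mul_apply, Function.comp_apply]
    ring
  · have h1 : Tendsto (fun i => m i * v i - k * v i) l (𝓝 (θ - k * 0)) :=
      hmv.sub (hv.const_mul _)
    rw [mul_zero, sub_zero] at h1
    refine h1.congr' ?_
    filter_upwards [hm.eventually_ge_atTop k] with i hi
    rw [Nat.cast_sub hi]
    ring

end Limits

/-! ### Chebyshev bound for truncated pre-spike times -/

section LawOfLargeNumbers

variable {Ω : Type*} [MeasurableSpace Ω] {P : Measure Ω} {σ : ℕ → Ω → ℝ} {T μ : ℝ}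

theorem measureReal_abs_preSpikeTime_truncated_sub_ge_le [IsProbabilityMeasure P]
    (hm : ∀ j, Measurable (σ j)) (hpos : ∀ j ω, 0 < σ j ω) (hσ : iIndepFun σ P) (hT : 0 ≤ T)
    (hμ : ∀ j, ∫ ω, min (σ j ω) T ∂P = μ) (K : ℕ) {η : ℝ} (hη : 0 < η) :
    P.real {ω | η ≤ |preSpikeTime (fun j => min (σ j ω) T) K - K * μ|} ≤ K * (T * μ) / η ^ 2 := by
  let Y : ℕ → Ω → ℝ := fun j ω => min (σ j ω) T
  have hYm (j) : Measurable (Y j) := (hm j).min measurable_const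
  have hY0 (j ω) : 0 ≤ Y j ω := le_min (hpos j ω).le hT
  have hYT (j ω) : Y j ω ≤ T := min_le_right _ _
  have hYL (p) (j) : MemLp (Y j) p P :=
    MemLp.of_bound (hYm j).aestronglyMeasurable T
      (Eventually.of_forall fun ω => by rw [Real.norm_of_nonneg (hY0 j ω)]; exact hYT j ω)
  -- Since `0 ≤ Y ≤ T`, one has `E[Y²] ≤ T E[Y]`; this is what makes the total variance vanish as `T
  -- → 0`.
  have hvar (j) : Var[Y j; P] ≤ T * μ := by
    refine (variance_le_expectation_sq (hYm j).aestronglyMeasurable).trans ?_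
    rw [← hμ j, ← integral_const_mul]
    refine integral_mono (hYL 2 j).integrable_sq (((hYL 1 j).integrable le_rfl).const_mul T)
      fun ω => ?_
    simp only [Pi.pow_apply, sq]
    exact mul_le_mul_of_nonneg_right (hYT j ω) (hY0 j ω)
  have hind : iIndepFun Y P := hσ.comp (fun _ y => min y T) fun _ => measurable_id.min measurable_const
  have hsum : Var[∑ j ∈ Finset.range K, Y j; P] ≤ K * (T * μ) := by
    rw [IndepFun.variance_sum (fun j _ => hYL 2 j) fun i _ j _ hij => hind.indepFun hij]
    exact (Finset.sum_le_card_nsmul _ _ _ fun j _ => hvar j).trans (by simp)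
  have hmean : P[∑ j ∈ Finset.range K, Y j] = K * μ := by
    simp only [Finset.sum_apply]
    rw [integral_finsetSum _ fun j _ => (hYL 1 j).integrable le_rfl]
    simp [Y, hμ]
  have hch := meas_ge_le_variance_div_sq (memLp_finsetSum' (Finset.range K) fun j _ => hYL 2 j) hη
  rw [hmean] at hch
  have h1 : P.real {ω | η ≤ |preSpikeTime (fun j => min (σ j ω) T) K - K * μ|} ≤
      Var[∑ j ∈ Finset.range K, Y j; P] / η ^ 2 := by
    rw [measureReal_def]
    refine ENNReal.toReal_le_of_le_ofReal (by positivity [variance_nonneg (∑ j ∈ Finset.range K, Y j) P]) ?_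
    simpa [preSpikeTime, Finset.sum_apply] using hch
  exact h1.trans (by gcongr)

end LawOfLargeNumbers

/-! ### Weak convergence on countable discrete spaces -/

section WeakConvergence

variable {ι : Type*} {l : Filter ι} [l.IsCountablyGenerated] {Ω : ι → Type*}
  [∀ i, MeasurableSpace (Ω i)] {P : ∀ i, Measure (Ω i)} [∀ i, IsProbabilityMeasure (P i)]
  {E : Type*} [MeasurableSpace E] [MeasurableSingletonClass E] [TopologicalSpace E]
  [DiscreteTopology E] [Countable E] [OpensMeasurableSpace E]

/-- The empty set and the singletons form a π-system containing a neighbourhood of each point inside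
any open set, so convergence on them suffices. -/
theorem tendsto_probabilityMeasure_of_tendsto_singleton {μ : ι → ProbabilityMeasure E}
    {ν : ProbabilityMeasure E} (h : ∀ k, Tendsto (fun i => μ i {k}) l (𝓝 (ν {k}))) :
    Tendsto μ l (𝓝 ν) := by
  refine IsPiSystem.tendsto_probabilityMeasure_of_tendsto_of_mem
    (S := {s | s.Subsingleton}) ?_ ?_ ?_ ?_
  · exact fun s hs t _ _ => hs.anti inter_subset_left
  · exact fun s hs => hs.measurableSet
  · exact fun u _ x hx => ⟨{x}, subsingleton_singleton, by simp, by simpa using hx⟩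
  · intro s hs
    rcases hs.eq_empty_or_singleton with rfl | ⟨k, rfl⟩
    · simpa using tendsto_const_nhds
    · exact h k

theorem tendsto_conditionalLaw_of_tendsto_singleton {B : ∀ i, Set (Ω i)} {N : ∀ i, Ω i → E}
    {ν : FiniteMeasure E} (hν : IsProbabilityMeasure (ν : Measure E)) (hB : ∀ᶠ i in l, 0 < (P i).real (B i))
    (hN : ∀ᶠ i in l, Measurable (N i))
    (h : ∀ k, Tendsto (fun i => (P i).real (B i ∩ N i ⁻¹' {k}) / (P i).real (B i)) l
      (𝓝 ((ν : Measure E).real {k}))) :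
    Tendsto (fun i => conditionalLaw (P i) (B i) (N i)) l (𝓝 ν) := by
  classical
  let ν' : ProbabilityMeasure E := ⟨ν, hν⟩
  -- The conditional law has mass one only eventually; elsewhere the limit law is a harmless
  -- default.
  let μ : ι → ProbabilityMeasure E := fun i =>
    if hi : IsProbabilityMeasure ((ProbabilityTheory.cond (P i) (B i)).map (N i))
      then ⟨(ProbabilityTheory.cond (P i) (B i)).map (N i), hi⟩ else ν'
  have hμ : ∀ᶠ i in l, (μ i : Measure E) = (ProbabilityTheory.cond (P i) (B i)).map (N i) := by
    filter_upwards [hB, hN] with i hBi hNi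
    have h0 : P i (B i) ≠ 0 := fun h0 => by simp [measureReal_def, h0] at hBi
    have := cond_isProbabilityMeasure h0
    have hi : IsProbabilityMeasure ((ProbabilityTheory.cond (P i) (B i)).map (N i)) :=
      Measure.isProbabilityMeasure_map hNi.aemeasurable
    have hμi : μ i = ⟨(ProbabilityTheory.cond (P i) (B i)).map (N i), hi⟩ := dif_pos hi
    rw [hμi]
    rfl
  have hlim : Tendsto μ l (𝓝 ν') := by
    refine tendsto_probabilityMeasure_of_tendsto_singleton fun k => ?_
    rw [← NNReal.tendsto_coe]
    refine (h k).congr' ?_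
    filter_upwards [hμ, hN] with i hi hNi
    have hk : MeasurableSet (N i ⁻¹' {k}) := hNi (measurableSet_singleton k)
    rw [← ProbabilityMeasure.measureReal_eq_coe_coeFn, hi, map_measureReal_apply hNi
      (measurableSet_singleton k), ProbabilityTheory.cond, measureReal_ennreal_smul_apply,
      measureReal_restrict_apply hk, ENNReal.toReal_inv, ← measureReal_def, inter_comm]
    exact div_eq_inv_mul _ _
  have := (ProbabilityMeasure.toFiniteMeasure_continuous.tendsto ν').comp hlim
  refine this.congr' ?_
  filter_upwards [hμ] with i hi
  exact Subtype.ext hi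

end WeakConvergence

/-- The sequence `σ` of independent positive random variables has the following characteristics:
`σ j` is larger than `T` with probability `p`, at least `α` with probability `p'`, in `[α, β]`
with probability `q`, and its truncation at `T` has mean `μ`. -/
structure IsRenewalRow {Ω : Type*} [MeasurableSpace Ω] (P : Measure Ω) (σ : ℕ → Ω → ℝ)
    (T α β p p' q μ : ℝ) : Prop where
  measurable : ∀ j, Measurable (σ j)
  pos : ∀ j ω, 0 < σ j ω
  indep : iIndepFun σ P
  pos_trunc : 0 < T
  left_le : α ≤ T
  right_le : β ≤ T
  prob_gt : ∀ j, P.real {ω | T < σ j ω} = p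
  prob_ge : ∀ j, P.real {ω | α ≤ σ j ω} = p'
  prob_mem : ∀ j, P.real {ω | σ j ω ∈ Icc α β} = q
  mean : ∀ j, ∫ ω, min (σ j ω) T ∂P = μ

theorem coe_independentPoissonLaw {κ : Type*} [Fintype κ] (r : κ → ℝ≥0) :
    (independentPoissonLaw r : Measure (κ → ℕ)) = Measure.pi fun k => poissonMeasure (r k) :=
  rfl

/-! ### Poisson limit for rows of independent interarrival times -/

section RenewalRows

variable {ι : Type*} {l : Filter ι} {Ω : ι → Type*}
  [∀ i, MeasurableSpace (Ω i)] {P : ∀ i, Measure (Ω i)} [∀ i, IsProbabilityMeasure (P i)]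
  {σ : ∀ i, ℕ → Ω i → ℝ} {T α β p p' q μ R : ι → ℝ}

theorem tendsto_measureReal_abs_preSpikeTime_truncated_sub
    (hrow : ∀ᶠ i in l, IsRenewalRow (P i) (σ i) (T i) (α i) (β i) (p i) (p' i) (q i) (μ i))
    (hT : Tendsto T l (𝓝 0)) {K : ι → ℕ} {θ : ℝ} (hK : Tendsto (fun i => K i * μ i) l (𝓝 θ))
    {η : ℝ} (hη : 0 < η) :
    Tendsto (fun i => (P i).real
      {ω | η ≤ |preSpikeTime (fun j => min (σ i j ω) (T i)) (K i) - θ|}) l (𝓝 0) := by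
  have hbound : Tendsto (fun i => K i * (T i * μ i) / (η / 2) ^ 2) l (𝓝 0) := by
    have := (hT.mul hK).div_const ((η / 2) ^ 2)
    rw [zero_mul, zero_div] at this
    exact this.congr fun i => by ring
  refine squeeze_zero' (Eventually.of_forall fun i => measureReal_nonneg) ?_ hbound
  have hclose : ∀ᶠ i in l, |K i * μ i - θ| < η / 2 := by
    simpa [Real.dist_eq] using (Metric.tendsto_nhds.1 hK) (η / 2) (half_pos hη)
  filter_upwards [hrow, hclose] with i hi hc
  refine (measureReal_mono fun ω hω => ?_).trans
    (measureReal_abs_preSpikeTime_truncated_sub_ge_le hi.measurable hi.pos hi.indep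
      hi.pos_trunc.le hi.mean (K i) (half_pos hη))
  rw [mem_ofPred_eq] at hω ⊢
  have h1 := abs_sub_le (preSpikeTime (fun j => min (σ i j ω) (T i)) (K i)) (K i * μ i) θ
  linarith

theorem tendsto_floor_mul_mul {s : ℝ} (hs : 0 ≤ s) (hR : Tendsto R l atTop) {u : ι → ℝ} {c : ℝ}
    (hu : Tendsto (fun i => R i * u i) l (𝓝 c)) :
    Tendsto (fun i => ⌊s * R i⌋₊ * u i) l (𝓝 (s * c)) := by
  refine (((tendsto_nat_floor_mul_div_atTop hs).comp hR).mul hu).congr' ?_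
  filter_upwards [hR.eventually_gt_atTop 0] with i hi
  simp only [Function.comp_apply]
  field_simp

/-- The truncated times at indices near `(s - η) R` and `(s + η) R` concentrate at `s - η` and `s +
η`, and a union bound over the indices between them costs `2 η A` in the limit. Then `η` is taken
small. -/
theorem tendsto_measureReal_not_isLocalized
    (hrow : ∀ᶠ i in l, IsRenewalRow (P i) (σ i) (T i) (α i) (β i) (p i) (p' i) (q i) (μ i))
    (hT : Tendsto T l (𝓝 0)) (hR : Tendsto R l atTop) {A : ℝ}
    (hp' : Tendsto (fun i => R i * p' i) l (𝓝 A)) (hμ : Tendsto (fun i => R i * μ i) l (𝓝 1))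
    {s : ℝ} (hs : 0 < s) :
    Tendsto (fun i => (P i).real {ω | ¬ ∃ lo hi,
      IsLocalized (fun j => σ i j ω) (T i) (α i) s lo ⌊s * R i⌋₊ hi}) l (𝓝 0) := by
  rw [Metric.tendsto_nhds]
  intro δ hδ
  obtain ⟨η, hη, hηs, hηA⟩ : ∃ η : ℝ, 0 < η ∧ η < s ∧ 2 * η * A < δ := by
    refine ⟨min (s / 2) (δ / (4 * (|A| + 1))), by positivity,
      (min_le_left _ _).trans_lt (half_lt_self hs), ?_⟩
    have h1 : min (s / 2) (δ / (4 * (|A| + 1))) ≤ δ / (4 * (|A| + 1)) := min_le_right _ _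
    have h0 : 0 ≤ min (s / 2) (δ / (4 * (|A| + 1))) := by positivity
    calc 2 * min (s / 2) (δ / (4 * (|A| + 1))) * A
        ≤ 2 * min (s / 2) (δ / (4 * (|A| + 1))) * (|A| + 1) := by
          gcongr
          linarith [le_abs_self A]
      _ ≤ 2 * (δ / (4 * (|A| + 1))) * (|A| + 1) := by gcongr
      _ = δ / 2 := by field_simp; ring
      _ < δ := half_lt_self hδ
  have hlo := tendsto_measureReal_abs_preSpikeTime_truncated_sub hrow hT
    (tendsto_floor_mul_mul (sub_pos.2 hηs).le hR hμ) hη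
  have hhi := tendsto_measureReal_abs_preSpikeTime_truncated_sub hrow hT
    (tendsto_floor_mul_mul (by linarith : 0 ≤ s + η) hR hμ) hη
  have hmid := (tendsto_floor_mul_mul (by linarith : 0 ≤ s + η) hR hp').sub
    (tendsto_floor_mul_mul (sub_pos.2 hηs).le hR hp')
  have hsum := (hlo.add hhi).add hmid
  have hlt : 0 + 0 + ((s + η) * A - (s - η) * A) < δ := by linarith
  filter_upwards [hsum.eventually_lt_const hlt, hrow, hR.eventually_gt_atTop 0] with i hi hr hRi
  rw [Real.dist_0_eq_abs, abs_of_nonneg measureReal_nonneg]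
  refine lt_of_le_of_lt ?_ hi
  set lo := ⌊(s - η) * R i⌋₊
  set hi' := ⌊(s + η) * R i⌋₊
  have hlom : lo ≤ ⌊s * R i⌋₊ := Nat.floor_mono (by gcongr; linarith)
  have hmhi : ⌊s * R i⌋₊ ≤ hi' := Nat.floor_mono (by gcongr; linarith)
  have hsub : {ω | ¬ ∃ lo hi, IsLocalized (fun j => σ i j ω) (T i) (α i) s lo ⌊s * R i⌋₊ hi} ⊆
      ({ω | η ≤ |preSpikeTime (fun j => min (σ i j ω) (T i)) lo - (s - η) * 1|} ∪
        {ω | η ≤ |preSpikeTime (fun j => min (σ i j ω) (T i)) hi' - (s + η) * 1|}) ∪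
        ⋃ j ∈ Finset.Ico lo hi', {ω | α i ≤ σ i j ω} := by
    intro ω hω
    by_contra hcon
    simp only [mem_union, mem_ofPred_eq, mem_iUnion, not_or, not_le, not_exists, mul_one,
      abs_lt, Finset.mem_Ico] at hcon
    exact hω ⟨lo, hi', hlom, hmhi, by linarith [hcon.1.1.2], by linarith [hcon.1.2.1],
      fun j h1 h2 => hcon.2 j ⟨h1, h2⟩⟩
  refine (measureReal_mono hsub).trans ((measureReal_union_le _ _).trans (add_le_add
    (measureReal_union_le _ _) ((measureReal_biUnion_finset_le _ _).trans ?_)))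
  rw [Finset.sum_congr rfl fun j _ => hr.prob_ge j, Finset.sum_const, Nat.card_Ico, nsmul_eq_mul,
    Nat.cast_sub (hlom.trans hmhi), sub_mul]

theorem exists_mem_Ico_castSucc_succ_iff {n : ℕ} {m : Fin (n + 2) → ℕ} (hm : Monotone m)
    (hm0 : m 0 = 0) (j : ℕ) :
    (∃ i : Fin (n + 1), j ∈ Finset.Ico (m i.castSucc) (m i.succ)) ↔ j < m (Fin.last (n + 1)) := by
  constructor
  · rintro ⟨i, hi⟩
    exact (Finset.mem_Ico.1 hi).2.trans_le (hm (Fin.le_last _))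
  · intro hj
    by_contra! hcon
    have : ∀ i, m i ≤ j := by
      intro i
      induction i using Fin.induction with
      | zero => omega
      | succ i ih =>
        by_contra! hlt
        exact hcon i (Finset.mem_Ico.2 ⟨ih, hlt⟩)
    exact absurd hj (not_lt.2 (this _))

theorem pairwise_disjoint_Ico_castSucc_succ {n : ℕ} {m : Fin (n + 2) → ℕ} (hm : Monotone m) :
    Pairwise fun i j : Fin (n + 1) => Disjoint (Finset.Ico (m i.castSucc) (m i.succ))
      (Finset.Ico (m j.castSucc) (m j.succ)) := by
  have key (i j : Fin (n + 1)) (hij : i < j) : Disjoint (Finset.Ico (m i.castSucc) (m i.succ))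
      (Finset.Ico (m j.castSucc) (m j.succ)) := by
    refine Finset.disjoint_left.2 fun a ha hb => ?_
    have h1 : m i.succ ≤ m j.castSucc := hm (Fin.succ_le_castSucc_iff.2 hij)
    have h2 := (Finset.mem_Ico.1 ha).2
    have h3 := (Finset.mem_Ico.1 hb).1
    omega
  intro i j hij
  rcases lt_or_gt_of_ne hij with h | h
  exacts [key i j h, (key j i h).symm]

/-- Events that agree off a set of vanishing probability have the same limiting probability. -/
theorem tendsto_measureReal_of_eventually_subset {E E' bad : ∀ i, Set (Ω i)} {c : ℝ}
    (hE' : Tendsto (fun i => (P i).real (E' i)) l (𝓝 c))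
    (hbad : Tendsto (fun i => (P i).real (bad i)) l (𝓝 0))
    (h : ∀ᶠ i in l, ∀ ω, ω ∉ bad i → (ω ∈ E i ↔ ω ∈ E' i)) :
    Tendsto (fun i => (P i).real (E i)) l (𝓝 c) := by
  have h1 := hE'.sub hbad
  have h2 := hE'.add hbad
  rw [sub_zero] at h1
  rw [add_zero] at h2
  refine tendsto_of_tendsto_of_tendsto_of_le_of_le' h1 h2 ?_ ?_
  · filter_upwards [h] with i hi
    have hsub : E' i ⊆ E i ∪ bad i := fun ω hω => by
      by_cases hb : ω ∈ bad i
      exacts [Or.inr hb, Or.inl ((hi ω hb).2 hω)]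
    linarith [(measureReal_mono hsub (μ := P i)).trans (measureReal_union_le _ _)]
  · filter_upwards [h] with i hi
    have hsub : E i ⊆ E' i ∪ bad i := fun ω hω => by
      by_cases hb : ω ∈ bad i
      exacts [Or.inr hb, Or.inl ((hi ω hb).1 hω)]
    exact (measureReal_mono hsub (μ := P i)).trans (measureReal_union_le _ _)

-- Off the bad event, both the conditioning event and the counts are read on deterministic blocks.
-- With `U = [α, β]` and `V` the rest of `(-∞, T]`, the block formula gives the joint probability;
-- the factors `exp (-(Δ k * J))` due to jumps cancel in the quotient.
set_option maxHeartbeats 400000 in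
theorem tendsto_conditionalLaw_renewalRow [l.IsCountablyGenerated]
    (hrow : ∀ᶠ i in l, IsRenewalRow (P i) (σ i) (T i) (α i) (β i) (p i) (p' i) (q i) (μ i))
    (hT : Tendsto T l (𝓝 0)) (hR : Tendsto R l atTop) {A J : ℝ} {lam : ℝ≥0}
    (hp : Tendsto (fun i => R i * p i) l (𝓝 J)) (hp' : Tendsto (fun i => R i * p' i) l (𝓝 A))
    (hq : Tendsto (fun i => R i * q i) l (𝓝 lam)) (hμ : Tendsto (fun i => R i * μ i) l (𝓝 1))
    {n : ℕ} {s : Fin (n + 2) → ℝ} (hs : StrictMono s) (hs0 : s 0 = 0)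
    {B : ∀ i, Set (Ω i)} {N : ∀ i, Ω i → Fin (n + 1) → ℕ}
    (hB : ∀ᶠ i in l, ∀ ω, ω ∈ B i ↔ ∀ k, T i < σ i k ω →
      s (Fin.last (n + 1)) ≤ preSpikeTime (fun j => σ i j ω) k + T i)
    (hN : ∀ᶠ i in l, ∀ ω k, N i ω k = {j : ℕ | preSpikeTime (fun j => σ i j ω) (j + 1) ∈
      Ioc (s k.castSucc) (s k.succ) ∧ σ i j ω ∈ Icc (α i) (β i)}.ncard) :
    (∀ᶠ i in l, 0 < (P i).real (B i)) ∧
    Tendsto (fun i => conditionalLaw (P i) (B i) (N i)) l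
      (𝓝 (independentPoissonLaw fun k : Fin (n + 1) =>
        (s k.succ - s k.castSucc).toNNReal * lam)) := by
  classical
  let m : ι → Fin (n + 2) → ℕ := fun i k => ⌊s k * R i⌋₊
  let I : ι → Fin (n + 1) → Finset ℕ := fun i k => Finset.Ico (m i k.castSucc) (m i k.succ)
  let Δ : Fin (n + 1) → ℝ := fun k => s k.succ - s k.castSucc
  have hΔ (k) : 0 < Δ k := sub_pos.2 (hs k.castSucc_lt_succ)
  have hs_nonneg (k) : 0 ≤ s k := hs0 ▸ hs.monotone (Fin.zero_le k)
  have hm0 (i) : m i 0 = 0 := by simp [m, hs0]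
  have hRpos := hR.eventually_gt_atTop 0
  have hmmono : ∀ᶠ i in l, Monotone (m i) := by
    filter_upwards [hRpos] with i hi k k' hk
    exact Nat.floor_mono (mul_le_mul_of_nonneg_right (hs.monotone hk) hi.le)
  let bad : ∀ i, Set (Ω i) := fun i => ⋃ k : Fin (n + 1), {ω | ¬ ∃ lo hi,
    IsLocalized (fun j => σ i j ω) (T i) (α i) (s k.succ) lo (m i k.succ) hi}
  have hbad : Tendsto (fun i => (P i).real (bad i)) l (𝓝 0) := by
    have h1 : Tendsto (fun i => ∑ k : Fin (n + 1), (P i).real {ω | ¬ ∃ lo hi,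
        IsLocalized (fun j => σ i j ω) (T i) (α i) (s k.succ) lo (m i k.succ) hi}) l
        (𝓝 (∑ k : Fin (n + 1), 0)) :=
      tendsto_finsetSum _ fun k _ => tendsto_measureReal_not_isLocalized hrow hT hR hp' hμ
        (hs0 ▸ hs k.succ_pos)
    rw [Finset.sum_const_zero] at h1
    exact squeeze_zero (fun i => measureReal_nonneg) (fun i => measureReal_iUnion_fintype_le _) h1
  have hgood {i} {ω : Ω i} (hω : ω ∉ bad i) (k : Fin (n + 1)) : ∃ lo hi,
      IsLocalized (fun j => σ i j ω) (T i) (α i) (s k.succ) lo (m i k.succ) hi := by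
    by_contra hcon
    exact hω (mem_iUnion.2 ⟨k, hcon⟩)
  -- cardinalities of the blocks
  have hcard {u : ι → ℝ} {c : ℝ} (hu : Tendsto (fun i => R i * u i) l (𝓝 c)) (k : Fin (n + 1)) :
      Tendsto (fun i => ((I i k).card : ℝ) * u i) l (𝓝 (Δ k * c)) := by
    have h1 := (tendsto_floor_mul_mul (hs_nonneg k.succ) hR hu).sub
      (tendsto_floor_mul_mul (hs_nonneg k.castSucc) hR hu)
    rw [← sub_mul] at h1
    refine h1.congr' ?_
    filter_upwards [hmmono] with i hi
    rw [Nat.card_Ico, Nat.cast_sub (hi k.castSucc_lt_succ.le), sub_mul]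
  have hcard_atTop (k : Fin (n + 1)) : Tendsto (fun i => (I i k).card) l atTop := by
    -- The choice `u = 1 / R` shows that the block size is equivalent to `Δ k * R`.
    have h1 : Tendsto (fun i => ((I i k).card : ℝ) * (R i)⁻¹) l (𝓝 (Δ k * 1)) := by
      refine hcard (tendsto_const_nhds.congr' ?_) k
      filter_upwards [hRpos] with i hi
      rw [mul_inv_cancel₀ hi.ne']
    rw [← tendsto_natCast_atTop_iff (R := ℝ)]
    refine (h1.pos_mul_atTop (by simpa using hΔ k) hR).congr' ?_
    filter_upwards [hRpos] with i hi
    field_simp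
  have hsmall {u : ι → ℝ} {c : ℝ} (hu : Tendsto (fun i => R i * u i) l (𝓝 c)) :
      Tendsto u l (𝓝 0) := by
    have h1 := (tendsto_inv_atTop_zero.comp hR).mul hu
    rw [zero_mul] at h1
    refine h1.congr' ?_
    filter_upwards [hRpos] with i hi
    simp only [Function.comp_apply]
    field_simp
  -- the no-jump event
  have hprob_le : ∀ᶠ i in l, ∀ j, (P i).real {ω | σ i j ω ∈ Iic (T i)} = 1 - p i := by
    filter_upwards [hrow] with i hi j
    rw [← hi.prob_gt j, ← probReal_compl_eq_one_sub (measurableSet_lt measurable_const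
      (hi.measurable j))]
    congr 1
    ext ω
    simp
  let C : ∀ i, Set (Ω i) := fun i => {ω | ∀ k, ∀ j ∈ I i k, σ i j ω ∈ Iic (T i)}
  have hC : Tendsto (fun i => (P i).real (C i)) l (𝓝 (∏ k, Real.exp (-(Δ k * J)))) := by
    have h1 : Tendsto (fun i => ∏ k, (1 - p i) ^ (I i k).card) l
        (𝓝 (∏ k, Real.exp (-(Δ k * J)))) :=
      tendsto_finsetProd _ fun k _ => tendsto_one_sub_pow_exp_neg (hcard hp k) (hsmall hp)
    refine h1.congr' ?_
    filter_upwards [hrow, hmmono, hprob_le] with i hi hmi hpi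
    rw [hi.indep.measureReal_forall_blocks (pairwise_disjoint_Ico_castSucc_succ hmi)
      (W := fun _ _ => Iic (T i)) fun _ _ => measurableSet_Iic]
    refine Finset.prod_congr rfl fun k _ => ?_
    rw [Finset.prod_congr rfl fun j _ => hpi j, Finset.prod_const]
  have hBC : ∀ᶠ i in l, ∀ ω, ω ∉ bad i → (ω ∈ B i ↔ ω ∈ C i) := by
    filter_upwards [hrow, hmmono, hB] with i hi hmi hBi ω hω
    obtain ⟨lo, hi', hloc⟩ := hgood hω (Fin.last n)
    rw [hBi, ← Fin.succ_last, hloc.noJump_iff (fun j => hi.pos j ω) hi.pos_trunc hi.left_le]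
    simp only [C, mem_ofPred_eq, mem_Iic, Fin.succ_last]
    constructor
    · exact fun h k j hj => h j ((exists_mem_Ico_castSucc_succ_iff hmi (hm0 i) j).1 ⟨k, hj⟩)
    · intro h j hj
      obtain ⟨k, hk⟩ := (exists_mem_Ico_castSucc_succ_iff hmi (hm0 i) j).2 hj
      exact h k j hk
  have hBlim := tendsto_measureReal_of_eventually_subset hC hbad hBC
  have hlimpos : 0 < ∏ k, Real.exp (-(Δ k * J)) := Finset.prod_pos fun _ _ => Real.exp_pos _
  have hBpos : ∀ᶠ i in l, 0 < (P i).real (B i) := hBlim.eventually_const_lt hlimpos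
  refine ⟨hBpos, ?_⟩
  have hNmeas : ∀ᶠ i in l, Measurable (N i) := by
    filter_upwards [hN, hrow] with i hNi hi
    refine measurable_pi_lambda _ fun k => ?_
    have : (fun ω => N i ω k) = fun ω => {j : ℕ | preSpikeTime (fun j => σ i j ω) (j + 1) ∈
      Ioc (s k.castSucc) (s k.succ) ∧ σ i j ω ∈ Icc (α i) (β i)}.ncard := funext fun ω => hNi ω k
    rw [this]
    exact measurable_ncard_of_forall fun j =>
      (measurable_preSpikeTime hi.measurable (j + 1) measurableSet_Ioc).inter
        (hi.measurable j measurableSet_Icc)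
  refine tendsto_conditionalLaw_of_tendsto_singleton
    (by rw [coe_independentPoissonLaw]; infer_instance) hBpos hNmeas fun κ => ?_
  let D : ∀ i, Set (Ω i) := fun i => {ω | ∀ k, (∀ j ∈ I i k, σ i j ω ∈ Icc (α i) (β i) ∪
    (Iic (T i) \ Icc (α i) (β i))) ∧
    ((I i k).filter fun j => σ i j ω ∈ Icc (α i) (β i)).card = κ k}
  have hpq : Tendsto (fun i => R i * (p i + q i)) l (𝓝 (J + lam)) := by
    simpa only [mul_add] using hp.add hq
  have hD : Tendsto (fun i => (P i).real (D i)) l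
      (𝓝 (∏ k, ((Δ k * lam) ^ κ k / (κ k).factorial * Real.exp (-(Δ k * (J + lam)))))) := by
    have h1 : Tendsto (fun i => ∏ k, ((I i k).card.choose (κ k) * q i ^ κ k *
        (1 - (p i + q i)) ^ ((I i k).card - κ k))) l
        (𝓝 (∏ k, ((Δ k * lam) ^ κ k / (κ k).factorial * Real.exp (-(Δ k * (J + lam)))))) :=
      tendsto_finsetProd _ fun k _ => tendsto_choose_mul_pow_mul_pow (κ k) (hcard_atTop k)
        (hcard hq k) (hcard hpq k) (hsmall hpq)
    refine h1.congr' ?_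
    filter_upwards [hrow, hmmono, hprob_le] with i hi hmi hpi
    refine (hi.indep.measureReal_block_counts hi.measurable
      (pairwise_disjoint_Ico_castSucc_succ hmi) measurableSet_Icc
      (measurableSet_Iic.diff measurableSet_Icc) disjoint_sdiff_right hi.prob_mem
      (fun j => ?_) κ).symm
    have h2 : {ω | σ i j ω ∈ Iic (T i) \ Icc (α i) (β i)} =
        {ω | σ i j ω ∈ Iic (T i)} \ {ω | σ i j ω ∈ Icc (α i) (β i)} := rfl
    -- Because `β ≤ T`, the set `V` has probability `1 - p - q`.
    have hsub : {ω | σ i j ω ∈ Icc (α i) (β i)} ⊆ {ω | σ i j ω ∈ Iic (T i)} :=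
      fun ω hω => hω.2.trans hi.right_le
    rw [h2, measureReal_sdiff hsub (hi.measurable j measurableSet_Icc), hpi, hi.prob_mem]
    ring
  have hBD : ∀ᶠ i in l, ∀ ω, ω ∉ bad i → (ω ∈ B i ∩ N i ⁻¹' {κ} ↔ ω ∈ D i) := by
    filter_upwards [hrow, hmmono, hBC, hN] with i hi hmi hBCi hNi ω hω
    have hU : Icc (α i) (β i) ∪ (Iic (T i) \ Icc (α i) (β i)) = Iic (T i) :=
      union_sdiff_cancel fun y hy => hy.2.trans hi.right_le
    have hDC : ω ∈ D i ↔ ω ∈ C i ∧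
        ∀ k, ((I i k).filter fun j => σ i j ω ∈ Icc (α i) (β i)).card = κ k := by
      simp only [D, C, hU, mem_ofPred_eq, forall_and]
    rw [hDC, mem_inter_iff, hBCi ω hω]
    refine and_congr_right fun hCω => ?_
    have hle : ∀ k, ∀ j < m i k, σ i j ω ≤ T i := by
      intro k j hj
      obtain ⟨k', hk'⟩ := (exists_mem_Ico_castSucc_succ_iff hmi (hm0 i) j).2
        (hj.trans_le (hmi (Fin.le_last k)))
      exact hCω k' j hk'
    have hcount := fun k => ncard_preSpikes_eq_card (σ := fun j => σ i j ω) (β := β i)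
      (fun j => hi.pos j ω) hs0 (hm0 i) hi.pos_trunc (hgood hω) hle k
    rw [mem_preimage, mem_singleton_iff, funext_iff]
    refine forall_congr' fun k => ?_
    rw [hNi, hcount]
  have hBDlim := tendsto_measureReal_of_eventually_subset hD hbad hBD
  have hfinal := hBDlim.div hBlim hlimpos.ne'
  have heq : (independentPoissonLaw fun k : Fin (n + 1) =>
      (s k.succ - s k.castSucc).toNNReal * lam : Measure (Fin (n + 1) → ℕ)).real {κ} = (∏ k, ((Δ k * lam) ^ κ k / (κ k).factorial * Real.exp (-(Δ k * (J + lam))))) /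
        ∏ k, Real.exp (-(Δ k * J)) := by
    rw [coe_independentPoissonLaw, measureReal_def, Measure.pi_singleton, ENNReal.toReal_prod, ← Finset.prod_div_distrib]
    refine Finset.prod_congr rfl fun k _ => ?_
    rw [← measureReal_def, poissonMeasure_real_singleton, NNReal.coe_mul,
      Real.coe_toNNReal _ (hΔ k).le, mul_add, neg_add, Real.exp_add]
    have := Real.exp_ne_zero (-(Δ k * J))
    simp only [Δ] at this ⊢
    field_simp
  rw [heq]
  exact hfinal

end RenewalRows

/-! ### Lower bounds for the drift -/

section Coefficients

variable {f h : ℝ → ℝ}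

theorem ModelCoefficients.h_zero_pos (hfh : ModelCoefficients f h) : 0 < h 0 :=
  hfh.h_pos 0 ⟨le_rfl, one_pos⟩

theorem exists_abs_sub_le_mul {g : ℝ → ℝ} (hg : ContDiffOn ℝ 2 g (Icc 0 1)) :
    ∃ K : ℝ, 0 < K ∧ ∀ u ∈ Icc (0 : ℝ) 1, |g u - g 0| ≤ K * u := by
  obtain ⟨K, hK⟩ := hg.exists_lipschitzOnWith (by decide) (convex_Icc _ _) isCompact_Icc
  refine ⟨K + 1, by positivity, fun u hu => ?_⟩
  have h1 := hK.dist_le_mul u hu 0 (left_mem_Icc.2 zero_le_one)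
  rw [Real.dist_eq, Real.dist_eq, sub_zero, abs_of_nonneg hu.1] at h1
  linarith [hu.1]

theorem ModelCoefficients.exists_lipschitz (hfh : ModelCoefficients f h) :
    ∃ K : ℝ, 0 < K ∧ ∀ u ∈ Icc (0 : ℝ) 1, |f u - f 0| ≤ K * u ∧ |h u - h 0| ≤ K * u := by
  obtain ⟨K, hK, hf⟩ := exists_abs_sub_le_mul hfh.f_contDiff
  obtain ⟨K', hK', hh⟩ := exists_abs_sub_le_mul hfh.h_contDiff
  refine ⟨K + K', by positivity, fun u hu => ⟨(hf u hu).trans ?_, (hh u hu).trans ?_⟩⟩ <;>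
  · gcongr
    · exact hu.1
    · linarith

/-- Near `1` the bound comes from `h'(1) < 0`; away from `1`, compactness gives a positive minimum
of `h`. -/
theorem ModelCoefficients.exists_mul_one_sub_le (hfh : ModelCoefficients f h) :
    ∃ κ : ℝ, 0 < κ ∧ ∀ u ∈ Icc (0 : ℝ) 1, κ * (1 - u) ≤ h u := by
  set d := derivWithin h (Icc 0 1) 1 with hd
  have hderiv : HasDerivWithinAt h d (Icc 0 1) 1 :=
    ((hfh.h_contDiff.differentiableOn (by decide)) 1
      (right_mem_Icc.2 zero_le_one)).hasDerivWithinAt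
  have hslope : Tendsto (slope h 1) (𝓝[<] 1) (𝓝 d) := by
    have h1 : HasDerivWithinAt h d (Iio 1) 1 :=
      (hderiv.mono Ico_subset_Icc_self).mono_of_mem_nhdsWithin (Ico_mem_nhdsLT one_pos)
    exact (hasDerivWithinAt_iff_tendsto_slope' (by simp)).1 h1
  have hslope_eq (u : ℝ) : slope h 1 u = -(h u / (1 - u)) := by
    rw [slope_def_field, hfh.h_one, sub_zero, ← neg_sub 1 u, div_neg]
  have hd0 : d < 0 := by
    -- Left difference quotients at `1` are nonpositive because `h ≥ 0 = h 1`; the derivative is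
    -- nonzero by assumption.
    refine lt_of_le_of_ne (le_of_tendsto hslope ?_) hfh.h_deriv_one
    filter_upwards [Ico_mem_nhdsLT one_pos] with u hu
    rw [hslope_eq, neg_nonpos]
    exact div_nonneg (hfh.h_pos u hu).le (sub_nonneg.2 hu.2.le)
  have hev : ∀ᶠ u in 𝓝[<] (1 : ℝ), -d / 2 * (1 - u) ≤ h u := by
    filter_upwards [hslope.eventually_lt_const (by linarith : d < d / 2), self_mem_nhdsWithin]
      with u hu hu1
    have h1 : 0 < 1 - u := sub_pos.2 hu1
    rw [hslope_eq] at hu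
    rw [← le_div_iff₀ h1]
    linarith
  obtain ⟨r, hr, hr'⟩ := (mem_nhdsLT_iff_exists_Ioo_subset' one_pos).1
    (inter_mem hev (Ioo_mem_nhdsLT one_pos))
  obtain ⟨z, hz, hmin⟩ := (isCompact_Icc (a := 0) (b := max r 0)).exists_isMinOn
    (nonempty_Icc.2 (le_max_right _ _)) (hfh.h_contDiff.continuousOn.mono
      (Icc_subset_Icc_right (max_le (le_of_lt hr) zero_le_one)))
  have hz1 : 0 < h z := hfh.h_pos z ⟨hz.1, hz.2.trans_lt (max_lt hr one_pos)⟩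
  refine ⟨min (h z) (-d / 2), lt_min hz1 (by linarith), fun u hu => ?_⟩
  have h1u : 0 ≤ 1 - u := sub_nonneg.2 hu.2
  rcases le_or_gt u (max r 0) with hur | hur
  · calc min (h z) (-d / 2) * (1 - u) ≤ h z * 1 := by
          gcongr
          · exact min_le_left _ _
          · linarith [hu.1]
      _ ≤ h u := by rw [mul_one]; exact hmin ⟨hu.1, hur⟩
  · rcases hu.2.eq_or_lt with rfl | hu1
    · simp [hfh.h_one]
    · refine le_trans ?_ (hr' ⟨(le_max_left _ _).trans_lt hur, hu1⟩).1
      gcongr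
      exact min_le_right _ _

theorem ModelCoefficients.exists_drift_ge (hfh : ModelCoefficients f h) :
    ∃ κ M : ℝ, 0 < κ ∧ 0 < M ∧ ∀ ε δ : ℝ, 0 < ε → M * ε ≤ δ → ∀ u ∈ Icc 0 (1 - δ),
      κ * ((u + ε) * (1 - u)) ≤ ε * f u + u * h u := by
  obtain ⟨K, hK, hL⟩ := hfh.exists_lipschitz
  obtain ⟨κ, hκ, hh⟩ := hfh.exists_mul_one_sub_le
  have hf0 := hfh.f_zero_pos
  -- Half of `κ u (1 - u)` absorbs the error `ε K u` of replacing `f u` by `f 0`; `M = 2 K / κ`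
  -- makes this possible up to `1 - δ`.
  refine ⟨min (f 0) (κ / 2), 2 * K / κ, lt_min hf0 (by positivity), by positivity, ?_⟩
  intro ε δ hε hδ u hu
  have hδ0 : 0 ≤ δ := le_trans (by positivity) hδ
  have hu1 : u ∈ Icc (0 : ℝ) 1 := ⟨hu.1, by linarith [hu.2]⟩
  have h1u : δ ≤ 1 - u := by linarith [hu.2]
  have h1 : f 0 - K * u ≤ f u := by linarith [(abs_le.1 (hL u hu1).1).1]
  have h2 := hh u hu1
  have h3 : ε * K ≤ κ / 2 * (1 - u) := by
    have : 2 * K / κ * ε ≤ 1 - u := hδ.trans h1u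
    rw [div_mul_eq_mul_div, div_le_iff₀ hκ] at this
    linarith
  have hu0 := hu.1
  have h1u0 : 0 ≤ 1 - u := hδ0.trans h1u
  have h4 : min (f 0) (κ / 2) * (u * (1 - u)) ≤ κ / 2 * (u * (1 - u)) := by
    gcongr; exact min_le_right _ _
  have h5 : min (f 0) (κ / 2) * (ε * (1 - u)) ≤ f 0 * (ε * 1) := by
    gcongr
    · exact min_le_left _ _
    · linarith
  have h6 : ε * (f 0 - K * u) ≤ ε * f u := by gcongr
  have h7 : u * (κ * (1 - u)) ≤ u * h u := by gcongr
  have h8 : u * (ε * K) ≤ u * (κ / 2 * (1 - u)) := by gcongr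
  nlinarith

end Coefficients

/-- The first time at which `x` reaches the level `y`. -/
noncomputable def hittingTime (x : ℝ → ℝ) (y : ℝ) : ℝ := sInf {s | 0 ≤ s ∧ y ≤ x s}

theorem IsCrossingTime.hittingTime_eq {x : ℝ → ℝ} {y T : ℝ} (hT : IsCrossingTime x y T) :
    hittingTime x y = T := by
  have : {s | 0 ≤ s ∧ y ≤ x s} = Ici T := by
    ext s
    constructor
    · exact fun hs => (hT.le_iff s hs.1).1 hs.2
    · exact fun hs => ⟨hT.pos.le.trans hs, (hT.le_iff s (hT.pos.le.trans hs)).2 hs⟩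
  rw [hittingTime, this, csInf_Ici]

theorem IsCrossingTime.apply_eq {x : ℝ → ℝ} {y T : ℝ} (hT : IsCrossingTime x y T) : x T = y :=
  le_antisymm (not_lt.1 fun h => lt_irrefl _ ((hT.lt_iff T hT.pos.le).1 h))
    ((hT.le_iff T hT.pos.le).2 le_rfl)

/-! ### The deterministic flow: crossing times and survival probability -/

section Flow

variable {f h : ℝ → ℝ} {ε : ℝ} {x : ℝ → ℝ}

theorem IsDeterministicFlow.continuousOn (hx : IsDeterministicFlow f h ε x) :
    ContinuousOn x (Ici 0) :=
  fun s hs => (hx.ode s hs).continuousWithinAt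

theorem IsDeterministicFlow.hasDerivAt (hx : IsDeterministicFlow f h ε x) {s : ℝ} (hs : 0 < s) :
    HasDerivAt x (ε⁻¹ * (ε * f (x s) + x s * h (x s))) s :=
  (hx.ode s hs.le).hasDerivAt (Ici_mem_nhds hs)

/-- A level with positive drift is a barrier from below. Touching it again at `s` would force a
nonpositive left derivative there. -/
theorem IsDeterministicFlow.lt_of_le (hx : IsDeterministicFlow f h ε x) (hε : 0 < ε) {y : ℝ}
    (hy : 0 < ε * f y + y * h y) {T s : ℝ} (hT : 0 ≤ T) (hTy : y ≤ x T) (hs : T < s) : y < x s := by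
  have hv : 0 < ε⁻¹ * (ε * f y + y * h y) := by positivity
  have hge : ∀ u ∈ Icc T s, y ≤ x u := by
    have := image_le_of_deriv_right_lt_deriv_boundary' (f := fun u => -x u)
      (f' := fun u => -(ε⁻¹ * (ε * f (x u) + x u * h (x u)))) (a := T) (b := s)
      (B := fun _ => -y) (B' := fun _ => 0)
      ((hx.continuousOn.mono fun u hu => hT.trans hu.1).neg)
      (fun u hu => ((hx.ode u (hT.trans hu.1)).mono
        (Ici_subset_Ici.2 (hT.trans hu.1))).neg)
      (neg_le_neg hTy) continuousOn_const (fun u _ => hasDerivWithinAt_const _ _ _)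
      (fun u _ hu => by
        have : x u = y := neg_injective hu
        rw [this]
        linarith)
    exact fun u hu => neg_le_neg_iff.1 (this hu)
  refine lt_of_le_of_ne (hge s (right_mem_Icc.2 hs.le)) fun heq => ?_
  have hd := (hx.hasDerivAt (hT.trans_lt hs)).hasDerivWithinAt (s := Iio s)
  rw [← heq, hasDerivWithinAt_iff_tendsto_slope' (by simp)] at hd
  refine absurd (le_of_tendsto hd ?_) (not_le.2 hv)
  filter_upwards [Ico_mem_nhdsLT hs] with u hu
  rw [slope_def_field, ← heq]
  exact div_nonpos_of_nonneg_of_nonpos (sub_nonneg.2 (hge u ⟨hu.1, hu.2.le⟩))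
    (sub_nonpos.2 hu.2.le)

theorem IsDeterministicFlow.exists_isCrossingTime (hx : IsDeterministicFlow f h ε x) (hε : 0 < ε)
    {y : ℝ} (hy0 : 0 < y) (hy : 0 < ε * f y + y * h y) (hex : ∃ s, 0 ≤ s ∧ y ≤ x s) :
    ∃ T, IsCrossingTime x y T := by
  obtain ⟨s₁, hs₁, hys₁⟩ := hex
  obtain ⟨T, hT, hxT⟩ := intermediate_value_Icc hs₁
    (hx.continuousOn.mono Icc_subset_Ici_self) ⟨by rw [hx.initial]; exact hy0.le, hys₁⟩
  have hlt {s} (hs : 0 ≤ s) (hsT : s < T) : x s < y := by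
    by_contra! hcon
    exact absurd (hx.lt_of_le hε hy hs hcon hsT) (by rw [hxT]; exact lt_irrefl _)
  have hT0 : 0 < T := lt_of_le_of_ne hT.1 fun h0 => by
    rw [← h0, hx.initial] at hxT
    exact hy0.ne hxT
  have hgt {s} (hsT : T < s) : y < x s := hx.lt_of_le hε hy hT.1 hxT.ge hsT
  refine ⟨T, hT0, fun s hs => ⟨fun hys => ?_, hgt⟩, fun s hs => ⟨fun hys => ?_, fun hTs => ?_⟩⟩
  · by_contra! hcon
    rcases hcon.eq_or_lt with rfl | hcon
    · exact hys.ne' hxT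
    · exact (hys.trans (hlt hs hcon)).false
  · by_contra! hcon
    exact (hys.trans_lt (hlt hs hcon)).false
  · rcases hTs.eq_or_lt with rfl | hTs
    · exact hxT.ge
    · exact (hgt hTs).le

/-- Below `1 - δ`, the function `V = log (x + ε) - log (1 - x)` grows at rate at least `κ / ε`,
starts at `log ε` and is at most `log 2 - log δ`. -/
theorem IsDeterministicFlow.le_of_forall_le (hx : IsDeterministicFlow f h ε x) (hε : 0 < ε)
    (hε1 : ε ≤ 1) {κ δ : ℝ} (hκ : 0 < κ) (hδ : 0 < δ)
    (hdrift : ∀ u ∈ Icc 0 (1 - δ), κ * ((u + ε) * (1 - u)) ≤ ε * f u + u * h u)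
    {S : ℝ} (hS : 0 ≤ S) (hle : ∀ s ∈ Icc 0 S, x s ≤ 1 - δ) :
    S ≤ ε / κ * (Real.log 2 - Real.log δ - Real.log ε) := by
  let V : ℝ → ℝ := fun s => Real.log (x s + ε) - Real.log (1 - x s)
  have hpos1 {s} (hs : 0 ≤ s) : 0 < x s + ε := by linarith [(hx.mem_Icc s hs).1]
  have hpos2 {s} (hs : s ∈ Icc 0 S) : 0 < 1 - x s := by linarith [hle s hs]
  have hV (s) (hs : s ∈ Icc 0 S) : HasDerivWithinAt V
      (ε⁻¹ * (ε * f (x s) + x s * h (x s)) / (x s + ε) -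
        -(ε⁻¹ * (ε * f (x s) + x s * h (x s))) / (1 - x s)) (Icc 0 S) s :=
    have hd := (hx.ode s hs.1).mono (Icc_subset_Ici_self : Icc 0 S ⊆ Ici 0)
    ((hd.add_const ε).log (hpos1 hs.1).ne').sub ((hd.const_sub 1).log (hpos2 hs).ne')
  have hbound := image_le_of_deriv_right_le_deriv_boundary
    (f := fun s => κ / ε * s) (f' := fun _ => κ / ε) (a := 0) (b := S)
    (B := fun s => V s - V 0) (by fun_prop)
    (fun s _ => by simpa using ((hasDerivAt_id s).const_mul (κ / ε)).hasDerivWithinAt) (by simp)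
    (B' := fun s => ε⁻¹ * (ε * f (x s) + x s * h (x s)) / (x s + ε) -
        -(ε⁻¹ * (ε * f (x s) + x s * h (x s))) / (1 - x s))
    (fun s hs => ((hV s hs).continuousWithinAt.sub continuousWithinAt_const))
    (fun s hs => ((hV s (Ico_subset_Icc_self hs)).mono_of_mem_nhdsWithin
      (Icc_mem_nhdsGE_of_mem hs)).sub_const _)
    (fun s hs => by
      have hs' := Ico_subset_Icc_self hs
      have h1 := hpos1 hs.1
      have h2 := hpos2 hs'
      have h3 := hdrift (x s) ⟨(hx.mem_Icc s hs.1).1, hle s hs'⟩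
      have h4 : ε⁻¹ * (ε * f (x s) + x s * h (x s)) / (x s + ε) -
          -(ε⁻¹ * (ε * f (x s) + x s * h (x s))) / (1 - x s) =
          ε⁻¹ * ((ε * f (x s) + x s * h (x s)) * (1 + ε) / ((x s + ε) * (1 - x s))) := by
        field_simp; ring
      rw [h4, div_eq_inv_mul]
      gcongr
      rw [le_div_iff₀ (by positivity)]
      have h5 : 0 ≤ κ * ((x s + ε) * (1 - x s)) := by positivity
      nlinarith) (right_mem_Icc.2 hS)
  have hVS : V S ≤ Real.log 2 - Real.log δ := by
    have h1 : x S + ε ≤ 2 := by linarith [(hx.mem_Icc S hS).2]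
    have h2 : δ ≤ 1 - x S := by linarith [hle S (right_mem_Icc.2 hS)]
    exact sub_le_sub (Real.log_le_log (hpos1 hS) h1) (Real.log_le_log hδ h2)
  have hV0 : V 0 = Real.log ε := by simp [V, hx.initial]
  rw [hV0] at hbound
  calc S = ε / κ * (κ / ε * S) := by field_simp
    _ ≤ _ := by gcongr; linarith

theorem IsDeterministicFlow.isCrossingTime_hittingTime (hx : IsDeterministicFlow f h ε x)
    (hε : 0 < ε) (hε1 : ε ≤ 1) {κ δ : ℝ} (hκ : 0 < κ) (hδ : 0 < δ)
    (hdrift : ∀ u ∈ Icc 0 (1 - δ), κ * ((u + ε) * (1 - u)) ≤ ε * f u + u * h u)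
    {y : ℝ} (hy : y ∈ Ioc 0 (1 - δ)) :
    IsCrossingTime x y (hittingTime x y) ∧
      hittingTime x y ≤ ε / κ * (Real.log 2 - Real.log δ - Real.log ε) := by
  set b := ε / κ * (Real.log 2 - Real.log δ - Real.log ε)
  have hpos : 0 < ε * f y + y * h y := by
    refine lt_of_lt_of_le ?_ (hdrift y ⟨hy.1.le, hy.2⟩)
    have := hy.1
    have : 0 < 1 - y := by linarith [hy.2]
    positivity
  have hex : ∃ s, 0 ≤ s ∧ y ≤ x s := by
    by_contra! hcon
    have := hx.le_of_forall_le hε hε1 hκ hδ hdrift (S := |b| + 1) (by positivity)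
      fun s hs => ((hcon s hs.1).trans_le hy.2).le
    linarith [le_abs_self b]
  obtain ⟨T, hT⟩ := hx.exists_isCrossingTime hε hy.1 hpos hex
  rw [hT.hittingTime_eq]
  refine ⟨hT, hx.le_of_forall_le hε hε1 hκ hδ hdrift hT.pos.le fun s hs => ?_⟩
  exact (not_lt.1 fun hlt => absurd ((hT.lt_iff s hs.1).1 hlt) (not_lt.2 hs.2)).trans hy.2

/-- The cumulative hazard `ε⁻¹ ∫₀ˢ h(x_u) du`. -/
noncomputable def cumulativeHazard (h : ℝ → ℝ) (ε : ℝ) (x : ℝ → ℝ) (s : ℝ) : ℝ :=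
  ε⁻¹ * ∫ u in (0 : ℝ)..s, h (x u)

theorem hasDerivWithinAt_integral_of_continuousOn_Ici {g : ℝ → ℝ} (hg : ContinuousOn g (Ici 0))
    {s : ℝ} (hs : 0 ≤ s) :
    HasDerivWithinAt (fun t => ∫ u in (0 : ℝ)..t, g u) (g s) (Ici 0) s := by
  -- Freezing `g` at its value at `0` on the negative axis gives a continuous function on the line
  -- with the same integrals.
  have hcont : Continuous fun u => g (max u 0) :=
    hg.comp_continuous (by fun_prop) fun u => mem_Ici.2 (le_max_right _ _)
  have h1 := (hcont.integral_hasStrictDerivAt 0 s).hasDerivAt.hasDerivWithinAt (s := Ici 0)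
  rw [max_eq_left hs] at h1
  have heq (t : ℝ) (ht : t ∈ Ici (0 : ℝ)) :
      ∫ u in (0 : ℝ)..t, g u = ∫ u in (0 : ℝ)..t, g (max u 0) := by
    refine intervalIntegral.integral_congr fun u hu => ?_
    rw [uIcc_of_le ht] at hu
    simp only [max_eq_left hu.1]
  exact h1.congr heq (heq s hs)

theorem cumulativeHazard_zero : cumulativeHazard h ε x 0 = 0 := by simp [cumulativeHazard]

theorem IsDeterministicFlow.hasDerivWithinAt_cumulativeHazard (hx : IsDeterministicFlow f h ε x)
    (hh : ContinuousOn h (Icc 0 1)) {s : ℝ} (hs : 0 ≤ s) :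
    HasDerivWithinAt (cumulativeHazard h ε x) (ε⁻¹ * h (x s)) (Ici 0) s :=
  (hasDerivWithinAt_integral_of_continuousOn_Ici
    (hh.comp hx.continuousOn fun u hu => hx.mem_Icc u hu) hs).const_mul _

theorem abs_sub_le_of_hasDerivWithinAt_Ici {g g' : ℝ → ℝ} {S C : ℝ} (hS : 0 ≤ S)
    (hg : ∀ s ∈ Icc 0 S, HasDerivWithinAt g (g' s) (Ici 0) s) (hC : ∀ s ∈ Icc 0 S, |g' s| ≤ C) :
    |g S - g 0| ≤ C * S := by
  simpa using norm_image_sub_le_of_norm_deriv_le_segment'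
    (fun s hs => (hg s hs).mono Icc_subset_Ici_self)
    (fun s hs => hC s (Ico_subset_Icc_self hs)) S (right_mem_Icc.2 hS)

variable {c K : ℝ}

/-- The choice `f 0 = c * h 0` cancels the singular terms: the derivative of the difference is `((f
x - f 0) - c (h x - h 0)) / (x + ε c)`, and the numerator is at most `K (1 + c) x`. -/
theorem IsDeterministicFlow.abs_log_sub_cumulativeHazard_le (hx : IsDeterministicFlow f h ε x)
    (hh : ContinuousOn h (Icc 0 1)) (hε : 0 < ε) (hc : 0 < c) (hf0 : f 0 = c * h 0)
    (hK : 0 ≤ K) (hL : ∀ u ∈ Icc (0 : ℝ) 1, |f u - f 0| ≤ K * u ∧ |h u - h 0| ≤ K * u)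
    {S : ℝ} (hS : 0 ≤ S) :
    |Real.log ((x S + ε * c) / (ε * c)) - cumulativeHazard h ε x S| ≤ K * (1 + c) * S := by
  have hpos {s} (hs : 0 ≤ s) : 0 < x s + ε * c :=
    add_pos_of_nonneg_of_pos (hx.mem_Icc s hs).1 (by positivity)
  have h1 := abs_sub_le_of_hasDerivWithinAt_Ici (C := K * (1 + c)) hS
    (g := fun s => Real.log (x s + ε * c) - cumulativeHazard h ε x s)
    (fun s hs => (((hx.ode s hs.1).add_const (ε * c)).log (hpos hs.1).ne').sub
      (hx.hasDerivWithinAt_cumulativeHazard hh hs.1)) fun s hs => by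
        have hxs := hx.mem_Icc s hs.1
        have hp := hpos hs.1
        have h2 : ε⁻¹ * (ε * f (x s) + x s * h (x s)) / (x s + ε * c) - ε⁻¹ * h (x s) =
            ((f (x s) - f 0) - c * (h (x s) - h 0)) / (x s + ε * c) := by
          rw [hf0]; field_simp; ring
        rw [h2, abs_div, abs_of_pos hp, div_le_iff₀ hp]
        calc |(f (x s) - f 0) - c * (h (x s) - h 0)|
            ≤ |f (x s) - f 0| + |c * (h (x s) - h 0)| := abs_sub _ _
          _ ≤ K * x s + c * (K * x s) := by
              rw [abs_mul, abs_of_pos hc]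
              gcongr
              exacts [(hL _ hxs).1, (hL _ hxs).2]
          _ = K * (1 + c) * x s := by ring
          _ ≤ K * (1 + c) * (x s + ε * c) := by
              gcongr
              linarith [mul_pos hε hc]
  rw [hx.initial, cumulativeHazard_zero, zero_add, sub_zero] at h1
  rw [Real.log_div (hpos hS).ne' (by positivity)]
  convert h1 using 2
  ring

theorem IsDeterministicFlow.exp_neg_cumulativeHazard_mem (hx : IsDeterministicFlow f h ε x)
    (hh : ContinuousOn h (Icc 0 1)) (hε : 0 < ε) (hc : 0 < c) (hf0 : f 0 = c * h 0)
    (hK : 0 ≤ K) (hL : ∀ u ∈ Icc (0 : ℝ) 1, |f u - f 0| ≤ K * u ∧ |h u - h 0| ≤ K * u)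
    {S : ℝ} (hS : 0 ≤ S) :
    Real.exp (-cumulativeHazard h ε x S) ∈ Icc
      (ε * c / (x S + ε * c) * Real.exp (-(K * (1 + c) * S)))
      (ε * c / (x S + ε * c) * Real.exp (K * (1 + c) * S)) := by
  have hpos : 0 < x S + ε * c :=
    add_pos_of_nonneg_of_pos (hx.mem_Icc S hS).1 (by positivity)
  have h1 := abs_le.1 (hx.abs_log_sub_cumulativeHazard_le hh hε hc hf0 hK hL hS)
  have h2 : ε * c / (x S + ε * c) = Real.exp (-Real.log ((x S + ε * c) / (ε * c))) := by
    rw [Real.exp_neg, Real.exp_log (by positivity), inv_div]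
  rw [h2, ← Real.exp_add, ← Real.exp_add]
  exact ⟨Real.exp_le_exp.2 (by linarith), Real.exp_le_exp.2 (by linarith)⟩

/-- The derivative of `(h 0 / ε) ∫ e^{-H} + e^{-H}` is `ε⁻¹ (h 0 - h x) e^{-H}`. Since `e^{-H}` is
of order `ε / (x + ε c)` and `|h x - h 0| ≤ K x`, it stays bounded. -/
theorem IsDeterministicFlow.abs_integral_exp_neg_cumulativeHazard_sub_le
    (hx : IsDeterministicFlow f h ε x)
    (hh : ContinuousOn h (Icc 0 1)) (hε : 0 < ε) (hc : 0 < c) (hf0 : f 0 = c * h 0)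
    (hK : 0 ≤ K) (hL : ∀ u ∈ Icc (0 : ℝ) 1, |f u - f 0| ≤ K * u ∧ |h u - h 0| ≤ K * u)
    {S : ℝ} (hS : 0 ≤ S) :
    |h 0 / ε * (∫ s in (0 : ℝ)..S, Real.exp (-cumulativeHazard h ε x s)) -
      (1 - Real.exp (-cumulativeHazard h ε x S))| ≤
      c * K * Real.exp (K * (1 + c) * S) * S := by
  have hH {s : ℝ} (hs : 0 ≤ s) := hx.hasDerivWithinAt_cumulativeHazard hh hs
  have hcont : ContinuousOn (fun s => Real.exp (-cumulativeHazard h ε x s)) (Ici 0) :=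
    fun s hs => (hH hs).continuousWithinAt.neg.rexp
  have h1 := abs_sub_le_of_hasDerivWithinAt_Ici (C := c * K * Real.exp (K * (1 + c) * S)) hS
    (g := fun s => h 0 / ε * (∫ u in (0 : ℝ)..s, Real.exp (-cumulativeHazard h ε x u)) +
      Real.exp (-cumulativeHazard h ε x s))
    (fun s hs => ((hasDerivWithinAt_integral_of_continuousOn_Ici hcont hs.1).const_mul _).add
      (hH hs.1).neg.exp) fun s hs => by
        have hxs := hx.mem_Icc s hs.1
        have hx0 := hxs.1
        have hp : 0 < x s + ε * c := add_pos_of_nonneg_of_pos hxs.1 (by positivity)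
        have h2 : h 0 / ε * Real.exp (-cumulativeHazard h ε x s) +
            Real.exp (-cumulativeHazard h ε x s) * -(ε⁻¹ * h (x s)) =
            Real.exp (-cumulativeHazard h ε x s) * (ε⁻¹ * -(h (x s) - h 0)) := by
          field_simp; ring
        rw [Pi.neg_apply, h2, abs_mul, abs_mul, abs_neg, abs_of_pos (Real.exp_pos _),
          abs_of_pos (inv_pos.2 hε)]
        calc Real.exp (-cumulativeHazard h ε x s) * (ε⁻¹ * |h (x s) - h 0|)
            ≤ (ε * c / (x s + ε * c) * Real.exp (K * (1 + c) * s)) * (ε⁻¹ * (K * x s)) := by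
              gcongr
              · exact (hx.exp_neg_cumulativeHazard_mem hh hε hc hf0 hK hL hs.1).2
              · exact (hL _ hxs).2
          _ = c * K * Real.exp (K * (1 + c) * s) * (x s / (x s + ε * c)) := by
              field_simp
          _ ≤ c * K * Real.exp (K * (1 + c) * S) * 1 := by
              gcongr
              · exact hs.2
              · rw [div_le_one hp]
                linarith [mul_pos hε hc]
          _ = _ := mul_one _
  rw [intervalIntegral.integral_same, cumulativeHazard_zero, neg_zero, Real.exp_zero, mul_zero,
    zero_add] at h1
  convert h1 using 2
  ring

end Flow

/-! ### Law of the interarrival times -/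

section Interarrival

variable {f h : ℝ → ℝ} {ε : ℝ} {x : ℝ → ℝ} {Ω : Type*} [MeasurableSpace Ω] {P : Measure Ω}
  {σ : ℕ → Ω → ℝ}

theorem IsInterarrivalSequence.measureReal_gt (hσ : IsInterarrivalSequence P h ε x σ) {t : ℝ}
    (ht : 0 < t) (j : ℕ) :
    P.real {ω | t < σ j ω} = Real.exp (-cumulativeHazard h ε x t) := by
  rw [measureReal_def, hσ.tail j t ht, ENNReal.toReal_ofReal (Real.exp_pos _).le]
  rfl

/-- The cumulative hazard is continuous, so the law has no atom at `t`. -/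
theorem IsInterarrivalSequence.measureReal_ge [IsProbabilityMeasure P]
    (hσ : IsInterarrivalSequence P h ε x σ) (hx : IsDeterministicFlow f h ε x)
    (hh : ContinuousOn h (Icc 0 1)) {t : ℝ} (ht : 0 < t) (j : ℕ) :
    P.real {ω | t ≤ σ j ω} = Real.exp (-cumulativeHazard h ε x t) := by
  refine le_antisymm ?_ ?_
  · have h1 : Tendsto (fun u => Real.exp (-cumulativeHazard h ε x u)) (𝓝[<] t)
        (𝓝 (Real.exp (-cumulativeHazard h ε x t))) :=
      (((hx.hasDerivWithinAt_cumulativeHazard hh ht.le).hasDerivAt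
        (Ici_mem_nhds ht)).continuousAt.neg.rexp).tendsto.mono_left nhdsWithin_le_nhds
    refine ge_of_tendsto h1 ?_
    filter_upwards [Ioo_mem_nhdsLT ht] with u hu
    rw [← hσ.measureReal_gt hu.1 j]
    exact measureReal_mono fun ω hω => lt_of_lt_of_le hu.2 hω
  · rw [← hσ.measureReal_gt ht j]
    exact measureReal_mono fun ω (hω : t < σ j ω) => hω.le

theorem IsInterarrivalSequence.isRenewalRow [IsProbabilityMeasure P]
    (hσ : IsInterarrivalSequence P h ε x σ) (hx : IsDeterministicFlow f h ε x)
    (hh : ContinuousOn h (Icc 0 1)) {T α β : ℝ} (hT : 0 < T) (hα : 0 < α) (hαβ : α ≤ β)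
    (hβT : β ≤ T) :
    IsRenewalRow P σ T α β (Real.exp (-cumulativeHazard h ε x T))
      (Real.exp (-cumulativeHazard h ε x α))
      (Real.exp (-cumulativeHazard h ε x α) - Real.exp (-cumulativeHazard h ε x β))
      (∫ s in (0 : ℝ)..T, Real.exp (-cumulativeHazard h ε x s)) where
  measurable := hσ.measurable
  pos := hσ.pos
  indep := hσ.indep
  pos_trunc := hT
  left_le := hαβ.trans hβT
  right_le := hβT
  prob_gt := hσ.measureReal_gt hT
  prob_ge := hσ.measureReal_ge hx hh hα
  prob_mem j := by
    have h1 : {ω | σ j ω ∈ Icc α β} = {ω | α ≤ σ j ω} \ {ω | β < σ j ω} := by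
      ext ω; simp
    have hsub : {ω | β < σ j ω} ⊆ {ω | α ≤ σ j ω} := fun ω hω => hαβ.trans (le_of_lt hω)
    rw [h1, measureReal_sdiff hsub
      (measurableSet_lt measurable_const (hσ.measurable j)), hσ.measureReal_ge hx hh hα,
      hσ.measureReal_gt (hα.trans_le hαβ)]
  mean j := by
    have hY0 (ω) : 0 ≤ min (σ j ω) T := le_min (hσ.pos j ω).le hT.le
    have hint : Integrable (fun ω => min (σ j ω) T) P :=
      Integrable.of_bound ((hσ.measurable j).min measurable_const).aestronglyMeasurable T
        (Eventually.of_forall fun ω => by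
          rw [Real.norm_of_nonneg (hY0 ω)]; exact min_le_right _ _)
    -- Layer-cake formula: the truncated mean is the integral of the tail over `(0, T]`.
    rw [hint.integral_eq_integral_Ioc_meas_le (Eventually.of_forall hY0)
      (Eventually.of_forall fun ω => min_le_right _ _), intervalIntegral.integral_of_le hT.le]
    refine setIntegral_congr_fun measurableSet_Ioc fun t ht => ?_
    rw [← hσ.measureReal_ge hx hh ht.1 j]
    congr 1
    ext ω
    simp [ht.2]

end Interarrival

/-! ### Asymptotic rates as `ε → 0` -/

section Asymptotics

theorem tendsto_mul_sub_log_sub_log {β : ℝ} (κ : ℝ) :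
    Tendsto (fun ε : ℝ => ε / κ * (Real.log 2 - Real.log (ε ^ β) - Real.log ε)) (𝓝[>] 0)
      (𝓝 0) := by
  have h1 : Tendsto (fun ε : ℝ => Real.log ε * ε) (𝓝[>] 0) (𝓝 0) := by
    have h := (Real.continuous_mul_log.tendsto 0).mono_left (nhdsWithin_le_nhds (s := Ioi 0))
    simpa [mul_comm] using h
  have h2 : Tendsto (fun ε : ℝ => ε) (𝓝[>] 0) (𝓝 0) := tendsto_nhdsWithin_of_tendsto_nhds tendsto_id
  have h3 := (((h2.mul_const (Real.log 2)).sub (h1.const_mul β)).sub h1).const_mul κ⁻¹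
  simp only [zero_mul, mul_zero, sub_zero] at h3
  refine h3.congr' ?_
  filter_upwards [self_mem_nhdsWithin] with ε hε
  rw [Real.log_rpow hε]
  ring

variable {f h : ℝ → ℝ} {x : ℝ → ℝ → ℝ}

theorem tendsto_mul_exp_neg_cumulativeHazard (hfh : ModelCoefficients f h)
    (hx : ∀ ε, 0 < ε → IsDeterministicFlow f h ε (x ε)) {S : ℝ → ℝ} {y : ℝ} (hy : 0 < y)
    (hS : ∀ᶠ ε in 𝓝[>] 0, 0 ≤ S ε) (hS0 : Tendsto S (𝓝[>] 0) (𝓝 0))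
    (hxS : Tendsto (fun ε => x ε (S ε)) (𝓝[>] 0) (𝓝 y)) :
    Tendsto (fun ε => h 0 / ε * Real.exp (-cumulativeHazard h ε (x ε) (S ε))) (𝓝[>] 0)
      (𝓝 (f 0 / y)) := by
  obtain ⟨K, hK, hL⟩ := hfh.exists_lipschitz
  have hh0 := hfh.h_zero_pos
  have hf0 := hfh.f_zero_pos
  obtain ⟨c, hc, hfc⟩ : ∃ c, 0 < c ∧ f 0 = c * h 0 :=
    ⟨f 0 / h 0, div_pos hf0 hh0, by field_simp⟩
  have hε0 : Tendsto (fun ε : ℝ => ε) (𝓝[>] 0) (𝓝 0) :=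
    tendsto_nhdsWithin_of_tendsto_nhds tendsto_id
  have hlim (C : ℝ) : Tendsto (fun ε => f 0 / (x ε (S ε) + ε * c) * Real.exp (C * S ε)) (𝓝[>] 0)
      (𝓝 (f 0 / y)) := by
    have h1 : Tendsto (fun ε => x ε (S ε) + ε * c) (𝓝[>] 0) (𝓝 y) := by
      simpa using hxS.add (hε0.mul_const c)
    have h2 : Tendsto (fun ε => Real.exp (C * S ε)) (𝓝[>] 0) (𝓝 1) := by
      simpa using (hS0.const_mul C).rexp
    simpa using ((tendsto_const_nhds (x := f 0)).div h1 hy.ne').mul h2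
  refine tendsto_of_tendsto_of_tendsto_of_le_of_le' (hlim (-(K * (1 + c)))) (hlim (K * (1 + c)))
    ?_ ?_
  all_goals
    filter_upwards [hS, self_mem_nhdsWithin] with ε hSε hε
    have hε : 0 < ε := hε
    have hmem := (hx ε hε).exp_neg_cumulativeHazard_mem hfh.h_contDiff.continuousOn hε hc hfc
      hK.le hL hSε
    have hpos : 0 < x ε (S ε) + ε * c :=
      add_pos_of_nonneg_of_pos ((hx ε hε).mem_Icc _ hSε).1 (by positivity)
    have heq (C : ℝ) : f 0 / (x ε (S ε) + ε * c) * Real.exp C =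
        h 0 / ε * (ε * c / (x ε (S ε) + ε * c) * Real.exp C) := by
      rw [hfc]; field_simp
    rw [heq]
    gcongr
  · rw [neg_mul]
    exact hmem.1
  · exact hmem.2

theorem tendsto_mul_integral_exp_neg_cumulativeHazard (hfh : ModelCoefficients f h)
    (hx : ∀ ε, 0 < ε → IsDeterministicFlow f h ε (x ε)) {S : ℝ → ℝ}
    (hS : ∀ᶠ ε in 𝓝[>] 0, 0 ≤ S ε) (hS0 : Tendsto S (𝓝[>] 0) (𝓝 0))
    (hp : Tendsto (fun ε => Real.exp (-cumulativeHazard h ε (x ε) (S ε))) (𝓝[>] 0) (𝓝 0)) :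
    Tendsto (fun ε => h 0 / ε * ∫ s in (0 : ℝ)..S ε, Real.exp (-cumulativeHazard h ε (x ε) s))
      (𝓝[>] 0) (𝓝 1) := by
  obtain ⟨K, hK, hL⟩ := hfh.exists_lipschitz
  have hh0 := hfh.h_zero_pos
  have hf0 := hfh.f_zero_pos
  obtain ⟨c, hc, hfc⟩ : ∃ c, 0 < c ∧ f 0 = c * h 0 :=
    ⟨f 0 / h 0, div_pos hf0 hh0, by field_simp⟩
  have hbound : Tendsto (fun ε => c * K * Real.exp (K * (1 + c) * S ε) * S ε) (𝓝[>] 0) (𝓝 0) := by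
    simpa using ((hS0.const_mul (K * (1 + c))).rexp.const_mul (c * K)).mul hS0
  have hdiff : Tendsto (fun ε =>
      h 0 / ε * (∫ s in (0 : ℝ)..S ε, Real.exp (-cumulativeHazard h ε (x ε) s)) -
        (1 - Real.exp (-cumulativeHazard h ε (x ε) (S ε)))) (𝓝[>] 0) (𝓝 0) := by
    refine squeeze_zero_norm' ?_ hbound
    filter_upwards [hS, self_mem_nhdsWithin] with ε hSε hε
    exact (hx ε hε).abs_integral_exp_neg_cumulativeHazard_sub_le hfh.h_contDiff.continuousOn hε hc
      hfc hK.le hL hSε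
  simpa using hdiff.add (hp.const_sub 1)

theorem spikeIntensity_Icc {a b : ℝ} (hf : 0 ≤ f 0) (ha : 0 < a) (hab : a ≤ b) (hb : b < 1) :
    spikeIntensity f (Icc a b) = ENNReal.ofReal (f 0 / a - f 0 / b) := by
  have hsub : Icc a b ⊆ Icc 0 1 := Icc_subset_Icc ha.le hb.le
  have hne {y : ℝ} (hy : y ∈ Icc a b) : y ≠ 0 := (ha.trans_le hy.1).ne'
  have hcont : ContinuousOn (fun y : ℝ => f 0 / y ^ 2) (Icc a b) :=
    continuousOn_const.div (by fun_prop) fun y hy => pow_ne_zero 2 (hne hy)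
  rw [spikeIntensity, withDensity_apply _ measurableSet_Icc, Measure.restrict_restrict
    measurableSet_Icc, inter_eq_left.2 hsub, ← ofReal_integral_eq_lintegral_ofReal
    (hcont.integrableOn_Icc) (Eventually.of_forall fun y => by positivity)]
  congr 1
  rw [integral_Icc_eq_integral_Ioc, ← intervalIntegral.integral_of_le hab]
  have hderiv (y : ℝ) (hy : y ∈ uIcc a b) : HasDerivAt (fun y => -(f 0 / y)) (f 0 / y ^ 2) y := by
    rw [uIcc_of_le hab] at hy
    exact ((hasDerivAt_inv (hne hy)).const_mul (f 0)).neg.congr_deriv (by ring)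
  rw [intervalIntegral.integral_eq_sub_of_hasDerivAt hderiv
    (by rw [← uIcc_of_le hab] at hcont; exact hcont.intervalIntegrable)]
  ring

end Asymptotics

/-! ### Assembly -/

theorem proposition3p2 (f h : ℝ → ℝ) (hfh : ModelCoefficients f h)
    (β : ℝ) (hβ : β ∈ Ioo (0 : ℝ) (1 / 2))
    (x : ℝ → ℝ → ℝ) (hx : ∀ ε, 0 < ε → IsDeterministicFlow f h ε (x ε))
    {Ω : ℝ → Type*} [∀ ε, MeasurableSpace (Ω ε)]
    (P : ∀ ε, Measure (Ω ε)) [∀ ε, IsProbabilityMeasure (P ε)]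
    (σ : ∀ ε, ℕ → Ω ε → ℝ)
    (hσ : ∀ ε, 0 < ε → IsInterarrivalSequence (P ε) h ε (x ε) (σ ε))
    (a b : ℝ) (ha : 0 < a) (hab : a ≤ b) (hb : b < 1)
    (n : ℕ) (s : Fin (n + 2) → ℝ) (hs : StrictMono s) (hs0 : s 0 = 0)
    (t : ℝ) (hst : s (Fin.last (n + 1)) = t) :
    (∀ᶠ ε in 𝓝[>] (0 : ℝ), 0 < P ε (noJumpEvent ε β (x ε) (σ ε) t)) ∧
    Tendsto
      (fun ε => conditionalLaw (P ε) (noJumpEvent ε β (x ε) (σ ε) t)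
        (countVector (x ε) (σ ε) s (Icc a b)))
      (𝓝[>] 0)
      (𝓝 (independentPoissonLaw fun i : Fin (n + 1) =>
        (s i.succ - s i.castSucc).toNNReal * (spikeIntensity f (Icc a b)).toNNReal)) := by
  subst hst
  obtain ⟨κ, M, hκ, hM, hdrift⟩ := hfh.exists_drift_ge
  have hh0 := hfh.h_zero_pos
  have hf0 := hfh.f_zero_pos
  have hh := hfh.h_contDiff.continuousOn
  have hb0 : 0 < b := ha.trans_le hab
  have hε0 : Tendsto (fun ε : ℝ => ε) (𝓝[>] 0) (𝓝 0) :=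
    tendsto_nhdsWithin_of_tendsto_nhds tendsto_id
  have hpos : ∀ᶠ ε : ℝ in 𝓝[>] 0, 0 < ε := self_mem_nhdsWithin
  have hδ : Tendsto (fun ε : ℝ => ε ^ β) (𝓝[>] 0) (𝓝 0) := by
    simpa [Real.zero_rpow hβ.1.ne'] using hε0.rpow_const (p := β) (Or.inr hβ.1.le)
  -- Since `β < 1`, `ε` is negligible against `ε ^ β`, so the drift bound holds up to the jump
  -- level.
  have hMδ : ∀ᶠ ε : ℝ in 𝓝[>] 0, M * ε ≤ ε ^ β := by
    have h1 : Tendsto (fun ε : ℝ => M * ε ^ (1 - β)) (𝓝[>] 0) (𝓝 0) := by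
      have hβ' : 0 < 1 - β := by linarith [hβ.2]
      simpa [Real.zero_rpow hβ'.ne'] using
        (hε0.rpow_const (p := 1 - β) (Or.inr hβ'.le)).const_mul M
    filter_upwards [h1.eventually_lt_const one_pos, hpos] with ε h2 hε
    have h3 : ε = ε ^ (1 - β) * ε ^ β := by
      rw [← Real.rpow_add hε, sub_add_cancel, Real.rpow_one]
    calc M * ε = M * ε ^ (1 - β) * ε ^ β := by rw [mul_assoc, ← h3]
      _ ≤ 1 * ε ^ β := by gcongr
      _ = ε ^ β := one_mul _
  let T : ℝ → ℝ := fun ε => hittingTime (x ε) (1 - ε ^ β)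
  let Ta : ℝ → ℝ := fun ε => hittingTime (x ε) a
  let Tb : ℝ → ℝ := fun ε => hittingTime (x ε) b
  let bd : ℝ → ℝ := fun ε => ε / κ * (Real.log 2 - Real.log (ε ^ β) - Real.log ε)
  have hbd : Tendsto bd (𝓝[>] 0) (𝓝 0) := tendsto_mul_sub_log_sub_log κ
  have hcross {y : ℝ → ℝ} (hy : ∀ᶠ ε in 𝓝[>] 0, y ε ∈ Ioc 0 (1 - ε ^ β)) :
      ∀ᶠ ε in 𝓝[>] 0, IsCrossingTime (x ε) (y ε) (hittingTime (x ε) (y ε)) ∧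
        hittingTime (x ε) (y ε) ≤ bd ε := by
    filter_upwards [hy, hpos, hMδ, hε0.eventually_le_const one_pos] with ε hyε hε hMε hε1
    exact (hx ε hε).isCrossingTime_hittingTime hε hε1 hκ (Real.rpow_pos_of_pos hε β)
      (hdrift ε _ hε hMε) hyε
  have hbδ : ∀ᶠ ε : ℝ in 𝓝[>] 0, b ≤ 1 - ε ^ β := by
    filter_upwards [hδ.eventually_le_const (sub_pos.2 hb)] with ε hε
    linarith
  have hcT := hcross (y := fun ε => 1 - ε ^ β) (hbδ.mono fun ε hε => ⟨hb0.trans_le hε, le_rfl⟩)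
  have hca := hcross (y := fun _ => a) (hbδ.mono fun ε hε => ⟨ha, hab.trans hε⟩)
  have hcb := hcross (y := fun _ => b) (hbδ.mono fun ε hε => ⟨hb0, hε⟩)
  have hsmall {y : ℝ → ℝ} (hc : ∀ᶠ ε in 𝓝[>] 0, IsCrossingTime (x ε) (y ε)
      (hittingTime (x ε) (y ε)) ∧ hittingTime (x ε) (y ε) ≤ bd ε) :
      Tendsto (fun ε => hittingTime (x ε) (y ε)) (𝓝[>] 0) (𝓝 0) :=
    squeeze_zero' (hc.mono fun ε h => h.1.pos.le) (hc.mono fun ε h => h.2) hbd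
  have htail {y : ℝ → ℝ} {y₀ : ℝ} (hy₀ : 0 < y₀) (hy : Tendsto y (𝓝[>] 0) (𝓝 y₀))
      (hc : ∀ᶠ ε in 𝓝[>] 0, IsCrossingTime (x ε) (y ε)
      (hittingTime (x ε) (y ε)) ∧ hittingTime (x ε) (y ε) ≤ bd ε) :=
    tendsto_mul_exp_neg_cumulativeHazard hfh hx hy₀ (hc.mono fun ε h => h.1.pos.le) (hsmall hc)
      (hy.congr' (hc.mono fun ε h => h.1.apply_eq.symm))
  have hR : Tendsto (fun ε => h 0 / ε) (𝓝[>] 0) atTop := by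
    simpa only [div_eq_mul_inv] using tendsto_inv_nhdsGT_zero.const_mul_atTop hh0
  -- The jump level `1 - ε ^ β` tends to `1`, so jumps occur at the limiting rate `f 0 / 1`.
  have hp := htail one_pos (by simpa using hδ.const_sub 1) hcT
  have hpa := htail ha tendsto_const_nhds hca
  have hpb := htail hb0 tendsto_const_nhds hcb
  -- The rescaled probability converges while `h 0 / ε → ∞`, so exceeding `T` has vanishing
  -- probability and the truncated mean is equivalent to `ε / h 0`.
  have hp0 : Tendsto (fun ε => Real.exp (-cumulativeHazard h ε (x ε) (T ε))) (𝓝[>] 0) (𝓝 0) := by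
    have h1 := (hε0.div_const (h 0)).mul hp
    rw [zero_div, zero_mul] at h1
    refine h1.congr' ?_
    filter_upwards [hpos] with ε hε
    simp only [T]
    field_simp
  have hμ := tendsto_mul_integral_exp_neg_cumulativeHazard hfh hx
    (hcT.mono fun ε h => h.1.pos.le) (hsmall hcT) hp0
  have hq : Tendsto (fun ε => h 0 / ε * (Real.exp (-cumulativeHazard h ε (x ε) (Ta ε)) -
      Real.exp (-cumulativeHazard h ε (x ε) (Tb ε)))) (𝓝[>] 0)
      (𝓝 ((spikeIntensity f (Icc a b)).toNNReal : ℝ)) := by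
    have hle : 0 ≤ f 0 / a - f 0 / b :=
      sub_nonneg.2 (div_le_div_of_nonneg_left hf0.le ha hab)
    have hval : ((spikeIntensity f (Icc a b)).toNNReal : ℝ) = f 0 / a - f 0 / b := by
      rw [spikeIntensity_Icc hf0.le ha hab hb]
      exact ENNReal.toReal_ofReal hle
    rw [hval]
    simpa only [mul_sub] using hpa.sub hpb
  have hrow : ∀ᶠ ε in 𝓝[>] 0, IsRenewalRow (P ε) (σ ε) (T ε) (Ta ε) (Tb ε)
      (Real.exp (-cumulativeHazard h ε (x ε) (T ε)))
      (Real.exp (-cumulativeHazard h ε (x ε) (Ta ε)))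
      (Real.exp (-cumulativeHazard h ε (x ε) (Ta ε)) -
        Real.exp (-cumulativeHazard h ε (x ε) (Tb ε)))
      (∫ s in (0 : ℝ)..T ε, Real.exp (-cumulativeHazard h ε (x ε) s)) := by
    filter_upwards [hpos, hcT, hca, hcb, hbδ] with ε hε hT hA hB hbε
    refine (hσ ε hε).isRenewalRow (hx ε hε) hh hT.1.pos hA.1.pos ?_ ?_
    · exact (hA.1.le_iff _ hB.1.pos.le).1 (by rw [hB.1.apply_eq]; exact hab)
    · exact (hB.1.le_iff _ hT.1.pos.le).1 (by rw [hT.1.apply_eq]; exact hbε)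
  have hmain := tendsto_conditionalLaw_renewalRow hrow (hsmall hcT) hR hp hpa hq hμ hs hs0
    (B := fun ε => noJumpEvent ε β (x ε) (σ ε) (s (Fin.last (n + 1))))
    (N := fun ε => countVector (x ε) (σ ε) s (Icc a b))
    (by
      filter_upwards [hpos, hcT, hbδ] with ε hε hT hbε ω
      exact le_firstJumpTime_iff (fun j => (hσ ε hε).pos j ω) (hb0.le.trans hbε) hT.1 _)
    (by
      filter_upwards [hpos, hca, hcb] with ε hε hA hB ω k
      exact preSpikeCount_eq (fun u hu => ((hx ε hε).hasDerivAt hu).continuousAt)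
        (fun j => (hσ ε hε).pos j ω) hA.1 hB.1 _ _)
  exact ⟨hmain.1.mono fun ε hε => (ENNReal.toReal_pos_iff.1 hε).1, hmain.2⟩
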